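/- Fix $p\ge 2$. A plane $p$-hypermap is a finite connected graph embedded in the sphere, up to orientation-preserving homeomorphism, whose faces are coloured dark or light so that adjacent faces have different colours and every dark face has degree $p$. It has type $(a_1,\dots,a_r)$ if its light faces are numbered $f_1,\dots,f_r$, with respective degrees $a_1,\dots,a_r$, and each bears one marked corner. The marked corner of a face counts as two different corners when a corner of this face is to be distinguished (one on each side of the mark), so that a face of degree $a$ has $a+1$ corners to distinguish. An orientation $\mathcal O$ (light-left or light-right) orients all edges $e$ from $e^-$ to $e^+$ so that light faces lie on the prescribed side; $\tilde{\mathcal O}$ is the reverse orientation. Paths follow oriented edges, and $\vec d$ is the directed distance; an edge $e$ is leaving a vertex $v$ if $\vec d(v,e^+)=\vec d(v,e^-)+1$. The corner preceding an edge $e$ is the corner at $e^-$ of the light face incident to $e$ between $e$ and the preceding edge of the contour of this face. The lightest geodesic from an edge or a light corner to a vertex $v'$ is the geodesic to $v'$ that starts from the end of this edge (the vertex of this corner) and whose successive edges are each the first edge going closer to $v'$ when one turns around the current vertex, from the edge by which one arrived (for a starting corner: from the edge entering this corner along its light face) towards the light face incident to that edge. Let $\boldsymbol a=(1,a_2,\dots,a_r)$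 and $\tilde{\boldsymbol a}=(\tilde a_2,\dots,\tilde a_r)=(a_2+1,a_3,\dots,a_r)$, with $r\ge2$, be tuples of positive integers, each with at most two coordinates that are not multiples of $p$; the light faces of hypermaps of type $\tilde{\boldsymbol a}$ are denoted by $\tilde f_2,\dots,\tilde f_r$. Fix an orientation $\mathcal O$. Let $\mathcal N$ be the set of $p$-hypermaps of type $\boldsymbol a$ with a distinguished corner $c$ in $f_2$. Let $\tilde{\mathcal N}$ be the set of $p$-hypermaps of type $\tilde{\boldsymbol a}$ with a distinguished vertex $\tilde v$ and a distinguished edge $\tilde e$ incident to $\tilde f_2$ and leaving $\tilde v$ for $\tilde{\mathcal O}$. Definition of $\Psi_-(\mathfrak m,c)=(\tilde{\mathfrak m},\tilde v,\tilde e)$. Use the orientation $\tilde{\mathcal O}$. Let $e_0$ be the edge incident to $f_1$, and $(e_1,\dots,e_k)$, $k\ge0$, the lightest geodesic from the corner of $f_1$ to the vertex of $c$. Slit the map from the corner of $f_1$ along this geodesic to the corner $c$, and sew the light side of $e_{i+1}$ onto the dark side of $e_i$ for $0\le i<k$; this suppresses $f_1$, and the dark side of $e_k$ becomes an edge $\tilde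 e$ incident to $\tilde f_2$, inserted at the corner $c$. Let $\tilde{\mathfrak m}$ be the resulting map and $\tilde v$ the origin in it of the edge carrying the dark side of $e_0$. Definition of $\Psi_+(\tilde{\mathfrak m},\tilde v,\tilde e)=(\mathfrak m,c)$. Use the orientation $\mathcal O$. Let $(e_1,\dots,e_k)$ be the lightest geodesic from the corner preceding $\tilde e$ to $\tilde v$. Slit the map from this corner along this geodesic, stopping at $\tilde v$ without disconnecting the map at $\tilde v$, and sew the light side of $e_{i+1}$ onto the dark side of $e_i$ for $1\le i<k$. The unmatched dark side of $e_k$ is then a loop enclosing a new light face $f_1$ of degree $1$, marked at its unique corner, and the unmatched light side of $e_1$ is removed from the contour of its face and replaced with the distinguished corner $c$. Let $\mathfrak m$ be the resulting map. **Theorem.** The mappings $\Psi_-\colon\mathcal N\to\tilde{\mathcal N}$ and $\Psi_+\colon\tilde{\mathcal N}\to\mathcal N$ are well defined and are mutually inverse bijections. -/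

import Mathlib

/-!
# Plane p-hypermaps, lightest geodesics, and the slit-slide-sew maps that suppress or add a
light face of degree one

A plane hypermap is encoded by its rotation system. Every edge has one light side and one dark
side. With the edges oriented so that light faces lie on their left, `light e` and `dark e` are
the edges that follow `e` in the contour of the light, respectively dark, face incident to `e`.
Light faces and dark faces are the cycles of `light` and of `dark`. The edge `light e` (and also
`dark e`) starts where `e` ends, so that the edges starting at a given vertex form a cycle
of `dark * light⁻¹`. Orientation-preserving homeomorphisms correspond to relabellings of the edges.
-/

/-- The two ways of orienting all the edges: light faces on the left or on the right. -/
inductive EdgeOrientation where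
  | lightLeft : EdgeOrientation
  | lightRight : EdgeOrientation

/-- The reverse orientation. -/
def EdgeOrientation.rev : EdgeOrientation → EdgeOrientation
  | .lightLeft => .lightRight
  | .lightRight => .lightLeft

/-- The data of a hypermap with edge set `E`: the contour permutations in the light-left
orientation, and marked corners of light faces indexed by `ι`.
A corner of a light face is denoted by the edge that follows it
in the contour of this face in the light-left orientation. -/
@[ext] structure PreHypermap (E : Type*) (ι : Type*) where
  light : Equiv.Perm E
  dark : Equiv.Perm E
  mark : ι → E

namespace PreHypermap

variable {E ι : Type*}

/-- The set of the edges incident to the light face incident to `e`. -/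
def lightFace (m : PreHypermap E ι) (e : E) : Set E := {x | m.light.SameCycle e x}

/-- The set of the edges incident to the dark face incident to `e`. -/
def darkFace (m : PreHypermap E ι) (e : E) : Set E := {x | m.dark.SameCycle e x}

/-- The vertex from which `e` starts in the light-left orientation. A vertex is
represented by the set of the edges that start from it in the light-left orientation. -/
def vertexOf (m : PreHypermap E ι) (e : E) : Set E := {x | (m.dark * m.light⁻¹).SameCycle e x}

/-- `m` is a plane `p`-hypermap whose light faces are numbered by `ι`,
each bearing one marked corner. -/
structure IsHypermap (p : ℕ) (m : PreHypermap E ι) : Prop where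
  /-- The underlying graph is connected. -/
  connected : ∀ e e' : E, ∃ g ∈ Subgroup.closure {m.light, m.dark}, g e = e'
  /-- The surface is a sphere: `#vertices - #edges + #faces = 2`. -/
  euler : (Set.range m.vertexOf).ncard
      + ((Set.range m.lightFace).ncard + (Set.range m.darkFace).ncard) = Nat.card E + 2
  /-- Dark faces have degree `p`. -/
  dark_degree : ∀ e : E, (m.darkFace e).ncard = p
  /-- Every light face has exactly one number, hence exactly one marked corner. -/
  marked : ∀ e : E, ∃! i : ι, e ∈ m.lightFace (m.mark i)

/-- The light face numbered `i` has degree `a i`. -/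
def HasType (m : PreHypermap E ι) (a : ι → ℕ) : Prop :=
  ∀ i, (m.lightFace (m.mark i)).ncard = a i

/-! ### Orientations, paths and geodesics -/

/-- The next edge in the contour of the incident light face, in the orientation `O`. -/
def lightNext (m : PreHypermap E ι) : EdgeOrientation → Equiv.Perm E
  | .lightLeft => m.light
  | .lightRight => m.light⁻¹

/-- The next edge in the contour of the incident dark face, in the orientation `O`. -/
def darkNext (m : PreHypermap E ι) : EdgeOrientation → Equiv.Perm E
  | .lightLeft => m.dark
  | .lightRight => m.dark⁻¹

/-- The origin `e⁻` of the edge `e` in the orientation `O`. -/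
def tail (m : PreHypermap E ι) : EdgeOrientation → E → Set E
  | .lightLeft, e => m.vertexOf e
  | .lightRight, e => m.vertexOf (m.light e)

/-- The end `e⁺` of the edge `e` in the orientation `O`. -/
def head (m : PreHypermap E ι) : EdgeOrientation → E → Set E
  | .lightLeft, e => m.vertexOf (m.light e)
  | .lightRight, e => m.vertexOf e

/-- The list of edges is a path from the vertex `v` to the vertex `w` in the orientation `O`. -/
def IsPath (m : PreHypermap E ι) (O : EdgeOrientation) : Set E → List E → Set E → Prop
  | v, [], w => v = w
  | v, e :: l, w => m.tail O e = v ∧ IsPath m O (m.head O e) l w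

/-- The directed distance from `v` to `w` in the orientation `O`. -/
noncomputable def dist (m : PreHypermap E ι) (O : EdgeOrientation) (v w : Set E) : ℕ :=
  sInf {k | ∃ l : List E, l.length = k ∧ m.IsPath O v l w}

/-- The edge `e` is leaving `v` in the orientation `O`. -/
def IsLeaving (m : PreHypermap E ι) (O : EdgeOrientation) (v : Set E) (e : E) : Prop :=
  m.dist O v (m.head O e) = m.dist O v (m.tail O e) + 1

/-- The edges starting from the end of `e`, listed by turning around this vertex in
the direction incoming edge `e`, light face incident to `e`: number `0` is the next edge in the
contour of this light face; one passes from an outgoing edge through a dark face to an incoming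
edge, and then through a light face to the next outgoing edge. -/
def turn (m : PreHypermap E ι) (O : EdgeOrientation) (e : E) (i : ℕ) : E :=
  ((m.lightNext O * (m.darkNext O)⁻¹) ^ i) (m.lightNext O e)

/-- The edge that follows `e` in the lightest geodesic towards `v`: the first edge in the above
enumeration that goes closer to `v`. -/
noncomputable def lightestEdge (m : PreHypermap E ι) (O : EdgeOrientation) (v : Set E) (e : E) : E :=
  m.turn O e (sInf {i | m.dist O (m.head O (m.turn O e i)) v + 1 = m.dist O (m.head O e) v})

/-- `k` steps of the construction of the lightest geodesic towards `v`, after the edge `e`. -/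
noncomputable def lightestSteps (m : PreHypermap E ι) (O : EdgeOrientation) (v : Set E) :
    ℕ → E → List E
  | 0, _ => []
  | k + 1, e => m.lightestEdge O v e :: lightestSteps m O v k (m.lightestEdge O v e)

/-- The lightest geodesic in the orientation `O` to the vertex `v`, started from the edge `e`
(which does not belong to the path), or, what is the same, from the corner that follows
`e` in the contour of its light face in the orientation `O`. -/
noncomputable def lightestGeodesic (m : PreHypermap E ι) (O : EdgeOrientation) (e : E) (v : Set E) :
    List E :=
  m.lightestSteps O v (m.dist O (m.head O e) v) e

end PreHypermap

/-! ### Maps with distinguished elements -/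

/-- A map with a distinguished corner of a light face. The mark of a face is seen as a dangling
half-edge, with one corner on each of its sides. Thus a corner is given by what follows it in
the contour of the face in the light-left orientation: an edge `e` (`Sum.inl e`) or the
mark number `i` (`Sum.inr i`). If the marked corner number `i` is `e`, then
`Sum.inr i` comes before the mark and `Sum.inl e` after it. -/
@[ext] structure CornerMap (E : Type*) (ι : Type*) where
  map : PreHypermap E ι
  corner : E ⊕ ι

/-- A map with a distinguished vertex and a distinguished edge. -/
@[ext] structure VertexEdgeMap (E : Type*) (ι : Type*) where
  map : PreHypermap E ι
  vertex : Set E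
  edge : E

namespace CornerMap

variable {E ι : Type*}

/-- The edge that follows the distinguished corner in the light-left orientation. -/
def cornerEdge (x : CornerMap E ι) : E := Sum.elim id x.map.mark x.corner

/-- The vertex incident to the distinguished corner. -/
def cornerVertex (x : CornerMap E ι) : Set E := x.map.vertexOf x.cornerEdge

/-- The distinguished corner lies in the light face numbered `i`. -/
def CornerInFace (x : CornerMap E ι) (i : ι) : Prop :=
  Sum.elim (fun e => e ∈ x.map.lightFace (x.map.mark i)) (fun j => j = i) x.corner

end CornerMap

/-! ### Relabelling of the edges, isomorphism classes -/

namespace PreHypermap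

variable {E ι : Type*}

/-- Relabelling of the edges. -/
def relabel (π : Equiv.Perm E) (m : PreHypermap E ι) : PreHypermap E ι where
  light := π * m.light * π⁻¹
  dark := π * m.dark * π⁻¹
  mark := fun i => π (m.mark i)

theorem relabel_one (m : PreHypermap E ι) : m.relabel 1 = m := by
  ext <;> simp [relabel]

theorem relabel_mul (π ρ : Equiv.Perm E) (m : PreHypermap E ι) :
    m.relabel (π * ρ) = (m.relabel ρ).relabel π := by
  ext <;> simp [relabel]

end PreHypermap

namespace CornerMap

variable {E ι : Type*}

/-- Relabelling of the edges. -/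
def relabel (π : Equiv.Perm E) (x : CornerMap E ι) : CornerMap E ι where
  map := x.map.relabel π
  corner := Sum.map π id x.corner

/-- Two maps with distinguished corners are identified if they differ by the edge labels. -/
def isoSetoid (E ι : Type*) : Setoid (CornerMap E ι) where
  r x y := ∃ π : Equiv.Perm E, x.relabel π = y
  iseqv := by
    have h1 : ∀ x : CornerMap E ι, x.relabel 1 = x := by
      intro x
      ext1
      · exact x.map.relabel_one
      · rcases h : x.corner <;> simp [relabel, h]
    have h2 : ∀ (π ρ : Equiv.Perm E) (x : CornerMap E ι),
        x.relabel (π * ρ) = (x.relabel ρ).relabel π := by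
      intro π ρ x
      ext1
      · exact x.map.relabel_mul π ρ
      · rcases h : x.corner <;> simp [relabel, h]
    refine ⟨fun x => ⟨1, h1 x⟩, ?_, ?_⟩
    · rintro x y ⟨π, rfl⟩
      exact ⟨π⁻¹, by rw [← h2, inv_mul_cancel, h1]⟩
    · rintro x y z ⟨π, rfl⟩ ⟨ρ, rfl⟩
      exact ⟨ρ * π, h2 ρ π x⟩

end CornerMap

namespace VertexEdgeMap

variable {E ι : Type*}

/-- Relabelling of the edges. -/
def relabel (π : Equiv.Perm E) (x : VertexEdgeMap E ι) : VertexEdgeMap E ι where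
  map := x.map.relabel π
  vertex := π '' x.vertex
  edge := π x.edge

/-- Two maps with distinguished vertices and edges are identified if they differ by the
edge labels. -/
def isoSetoid (E ι : Type*) : Setoid (VertexEdgeMap E ι) where
  r x y := ∃ π : Equiv.Perm E, x.relabel π = y
  iseqv := by
    have h1 : ∀ x : VertexEdgeMap E ι, x.relabel 1 = x := by
      intro x
      ext1
      · exact x.map.relabel_one
      · simp [relabel]
      · simp [relabel]
    have h2 : ∀ (π ρ : Equiv.Perm E) (x : VertexEdgeMap E ι),
        x.relabel (π * ρ) = (x.relabel ρ).relabel π := by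
      intro π ρ x
      ext1
      · exact x.map.relabel_mul π ρ
      · simp [relabel, Set.image_image]
      · simp [relabel]
    refine ⟨fun x => ⟨1, h1 x⟩, ?_, ?_⟩
    · rintro x y ⟨π, rfl⟩
      exact ⟨π⁻¹, by rw [← h2, inv_mul_cancel, h1]⟩
    · rintro x y z ⟨π, rfl⟩ ⟨ρ, rfl⟩
      exact ⟨ρ * π, h2 ρ π x⟩

end VertexEdgeMap

/-! ### Slit, slide, sew

The map is the result of gluing its light and dark faces (polygons), each edge being
the gluing of a light side and a dark side. After an operation an edge keeps the name of its
dark side, so that `dark` never changes: only the light sides are moved. -/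

section SlitSlideSew

variable {E ι : Type*} [DecidableEq E]

/-- For a list `(e₁, …, eₖ)` of distinct edges, slit these edges and sew
the light side of `eᵢ₊₁` onto the dark side of `eᵢ` for `1 ≤ i < k`, and the light side of
`e₁` onto the dark side of `eₖ`. Here `L.formPerm` maps `eᵢ` to `eᵢ₊₁` and `eₖ` to `e₁`, that is,
an edge of the new map to the old edge that had the same light side. -/
def CornerMap.slide (L : List E) (x : CornerMap E ι) : CornerMap E ι where
  map :=
    { light := L.formPerm⁻¹ * x.map.light * L.formPerm
      dark := x.map.dark
      mark := fun i => L.formPerm⁻¹ (x.map.mark i) }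
  corner := Sum.map (L.formPerm⁻¹ : Equiv.Perm E) id x.corner

/-- Insert at the distinguished corner a light side for the edge `z`. (The light side that `z`
had, which is required to form the contour of a light face of degree `1`, is discarded.) If the
distinguished corner is the one that lies after the mark of its face,
then the mark is now in the corner that precedes `z`; if it is the one that lies before the mark,
then the mark is now in the corner that follows `z`. -/
def CornerMap.insertSide (z : E) (x : CornerMap E ι) : PreHypermap E ι where
  light := Equiv.swap z x.cornerEdge * x.map.light
  dark := x.map.dark
  mark := Sum.elim (fun e i => if x.map.mark i = e then z else x.map.mark i)
    (fun _ i => x.map.mark i) x.corner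

open Classical in
/-- Remove the light side of the edge `z` from the contour of its light face,
and replace it with a distinguished corner. The mark of the face, if it was in one of the
two corners at the extremities of this side, is now in the corner that replaces them, and the
distinguished corner is then on the side of the mark where the removed light side was.
(The edge `z` is then given the contour of a separate light face of degree `1`.) -/
noncomputable def PreHypermap.removeSide (z : E) (m : PreHypermap E ι) : CornerMap E ι where
  map :=
    { light := Equiv.swap z (m.light z) * m.light
      dark := m.dark
      mark := fun i => if m.mark i = z then m.light z else m.mark i }
  corner := if h : ∃ i, m.mark i = m.light z then Sum.inr h.choose else Sum.inl (m.light z)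

end SlitSlideSew

/-! ### Suppressing and adding a light face of degree one, on labelled maps

In maps with `s + 2` light faces, the faces `f₁, f₂, …` have the numbers `0, 1, …`.
In maps with `s + 1` light faces, the faces `f̃₂, f̃₃, …` have the numbers `0, 1, …`. -/

section Psi

variable {E : Type*} [DecidableEq E] {s : ℕ}

/-- Suppression of the face `f₁` of degree `1`. Let `d₀` be its edge and `(e₁, …, eₖ)` the
lightest geodesic from its corner to the vertex of the distinguished corner `c`, in the
orientation reverse to `O`. With `e₀ = d₀`, the light side of `eᵢ₊₁` is sewn onto the dark side of
`eᵢ`, for `0 ≤ i < k`, and the dark side of `eₖ` becomes incident to the face of `c`, at `c`.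
The distinguished edge is `eₖ`, and the distinguished vertex is the origin of `e₀`. -/
noncomputable def CornerMap.suppress (O : EdgeOrientation) (x : CornerMap E (Fin (s + 2))) :
    VertexEdgeMap E (Fin (s + 1)) :=
  let d₀ : E := x.map.mark 0
  let γ : List E := x.map.lightestGeodesic O.rev d₀ x.cornerVertex
  let last : E := γ.getLastD d₀
  let m : PreHypermap E (Fin (s + 2)) := (x.slide (d₀ :: γ)).insertSide last
  let m' : PreHypermap E (Fin (s + 1)) := ⟨m.light, m.dark, fun i => m.mark i.succ⟩
  ⟨m', m'.tail O.rev d₀, last⟩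

/-- Addition of a face `f₁` of degree `1`. Let `(e₁, …, eₖ)` be the lightest geodesic from the
corner that precedes the distinguished edge to the distinguished vertex, in the orientation `O`.
The light side of `eᵢ₊₁` is sewn onto the dark side of `eᵢ` for `1 ≤ i < k`, the light side
of `e₁` is replaced with a distinguished corner, and the edge `eₖ` becomes a loop that encloses
the new face `f₁`. -/
noncomputable def VertexEdgeMap.addFace (O : EdgeOrientation) (y : VertexEdgeMap E (Fin (s + 1))) :
    CornerMap E (Fin (s + 2)) :=
  let γ : List E := y.map.lightestGeodesic O ((y.map.lightNext O)⁻¹ y.edge) y.vertex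
  let x : CornerMap E (Fin (s + 1)) := (y.map.removeSide (γ.headD y.edge)).slide γ
  ⟨⟨x.map.light, x.map.dark, Fin.cons (γ.getLastD y.edge) x.map.mark⟩,
    Sum.map id Fin.succ x.corner⟩

end Psi

/-! ### The two operations do not depend on the labels -/

namespace PreHypermap

variable {E ι : Type*} (π : Equiv.Perm E) (m : PreHypermap E ι) (O : EdgeOrientation)

theorem vertexOf_relabel (e : E) : (m.relabel π).vertexOf (π e) = π '' m.vertexOf e := by
  have h : (m.relabel π).dark * (m.relabel π).light⁻¹ = π * (m.dark * m.light⁻¹) * π⁻¹ := by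
    simp [relabel, mul_assoc]
  ext x
  rw [Equiv.image_eq_preimage_symm]
  simp only [vertexOf, h, Equiv.Perm.sameCycle_conj]
  simp [Equiv.Perm.inv_def]

theorem tail_relabel (e : E) : (m.relabel π).tail O (π e) = π '' m.tail O e := by
  cases O
  · exact vertexOf_relabel π m e
  · simp only [tail, ← vertexOf_relabel]; simp [relabel]

theorem head_relabel (e : E) : (m.relabel π).head O (π e) = π '' m.head O e := by
  cases O
  · simp only [head, ← vertexOf_relabel]; simp [relabel]
  · exact vertexOf_relabel π m e

theorem lightNext_relabel : (m.relabel π).lightNext O = π * m.lightNext O * π⁻¹ := by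
  cases O <;> simp [lightNext, relabel, mul_assoc]

theorem darkNext_relabel : (m.relabel π).darkNext O = π * m.darkNext O * π⁻¹ := by
  cases O <;> simp [darkNext, relabel, mul_assoc]

theorem isPath_relabel (v w : Set E) (l : List E) :
    (m.relabel π).IsPath O (π '' v) (l.map π) (π '' w) ↔ m.IsPath O v l w := by
  induction l generalizing v with
  | nil => exact π.injective.image_injective.eq_iff
  | cons e l ih =>
    simp only [List.map_cons, IsPath, tail_relabel, head_relabel, ih,
      π.injective.image_injective.eq_iff]

theorem dist_relabel (v w : Set E) :
    (m.relabel π).dist O (π '' v) (π '' w) = m.dist O v w := by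
  unfold dist
  congr 1
  ext k
  constructor
  · rintro ⟨l, rfl, h⟩
    refine ⟨l.map π.symm, by simp, ?_⟩
    rw [← isPath_relabel π]
    simpa [List.map_map] using h
  · rintro ⟨l, rfl, h⟩
    exact ⟨l.map π, by simp, (isPath_relabel π m O v w l).2 h⟩

theorem turn_relabel (e : E) (i : ℕ) : (m.relabel π).turn O (π e) i = π (m.turn O e i) := by
  have h : (m.relabel π).lightNext O * ((m.relabel π).darkNext O)⁻¹
      = π * (m.lightNext O * (m.darkNext O)⁻¹) * π⁻¹ := by
    rw [lightNext_relabel, darkNext_relabel]; group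
  unfold turn
  rw [h, conj_pow, lightNext_relabel]
  simp

theorem lightestEdge_relabel (v : Set E) (e : E) :
    (m.relabel π).lightestEdge O (π '' v) (π e) = π (m.lightestEdge O v e) := by
  simp only [lightestEdge, turn_relabel, head_relabel, dist_relabel]

theorem lightestSteps_relabel (v : Set E) (k : ℕ) (e : E) :
    (m.relabel π).lightestSteps O (π '' v) k (π e) = (m.lightestSteps O v k e).map π := by
  induction k generalizing e with
  | zero => rfl
  | succ k ih => simp only [lightestSteps, lightestEdge_relabel, ih, List.map_cons]

theorem lightestGeodesic_relabel (v : Set E) (e : E) :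
    (m.relabel π).lightestGeodesic O (π e) (π '' v) = (m.lightestGeodesic O e v).map π := by
  simp only [lightestGeodesic, head_relabel, dist_relabel, lightestSteps_relabel]

end PreHypermap

section Relabel

variable {E ι : Type*} (π : Equiv.Perm E)

theorem CornerMap.cornerEdge_relabel (x : CornerMap E ι) :
    (x.relabel π).cornerEdge = π x.cornerEdge := by
  rcases h : x.corner <;> simp [cornerEdge, relabel, h, PreHypermap.relabel]

theorem CornerMap.cornerVertex_relabel (x : CornerMap E ι) :
    (x.relabel π).cornerVertex = π '' x.cornerVertex := by
  unfold cornerVertex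
  rw [cornerEdge_relabel, ← PreHypermap.vertexOf_relabel]
  rfl

theorem getLastD_map_perm (L : List E) (a : E) : (L.map π).getLastD (π a) = π (L.getLastD a) := by
  rw [List.getLastD_eq_getLast?, List.getLastD_eq_getLast?, List.getLast?_map]
  cases L.getLast? <;> rfl

theorem headD_map_perm (L : List E) (a : E) : (L.map π).headD (π a) = π (L.headD a) := by
  cases L <;> rfl

variable [DecidableEq E]

theorem formPerm_map_perm (L : List E) : (L.map π).formPerm = π * L.formPerm * π⁻¹ := by
  induction L with
  | nil => simp
  | cons a L ih =>
    cases L with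
    | nil => simp
    | cons b L =>
      simp only [List.map_cons, List.formPerm_cons_cons] at ih ⊢
      rw [ih, Equiv.swap_apply_apply]
      group

theorem CornerMap.slide_relabel (L : List E) (x : CornerMap E ι) :
    (x.relabel π).slide (L.map π) = (x.slide L).relabel π := by
  have h : ((L.map π).formPerm)⁻¹ = π * L.formPerm⁻¹ * π⁻¹ := by
    rw [formPerm_map_perm]; group
  ext1
  · ext1
    · simp only [slide, relabel, PreHypermap.relabel, formPerm_map_perm]; group
    · rfl
    · ext i; simp [slide, relabel, PreHypermap.relabel, h]
  · rcases hc : x.corner <;> simp [slide, relabel, hc, h]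

theorem CornerMap.insertSide_relabel (z : E) (x : CornerMap E ι) :
    (x.relabel π).insertSide (π z) = (x.insertSide z).relabel π := by
  ext1
  · simp only [insertSide, cornerEdge_relabel, PreHypermap.relabel, Equiv.swap_apply_apply]
    simp only [relabel, PreHypermap.relabel]
    group
  · rfl
  · ext i
    rcases hc : x.corner with e | j
    · simp only [insertSide, relabel, PreHypermap.relabel, hc, Sum.map_inl, Sum.elim_inl,
        π.injective.eq_iff]
      split_ifs <;> rfl
    · simp [insertSide, relabel, PreHypermap.relabel, hc]

theorem PreHypermap.removeSide_relabel (z : E) (m : PreHypermap E ι) :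
    (m.relabel π).removeSide (π z) = (m.removeSide z).relabel π := by
  have hl : (m.relabel π).light (π z) = π (m.light z) := by simp [relabel]
  have hm : ∀ i, (m.relabel π).mark i = π (m.mark i) := fun _ => rfl
  ext1
  · ext1
    · simp only [removeSide, hl, CornerMap.relabel]
      simp only [relabel, Equiv.swap_apply_apply]
      group
    · rfl
    · ext i
      simp only [removeSide, hl, hm, CornerMap.relabel, π.injective.eq_iff]
      simp only [relabel]
      split_ifs <;> rfl
  · have hP : (fun i => (m.relabel π).mark i = (m.relabel π).light (π z))
        = fun i => m.mark i = m.light z := by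
      funext i
      rw [hl, hm, π.injective.eq_iff]
    have hc : ∀ (P Q : ι → Prop) (h : ∃ i, P i) (h' : ∃ i, Q i), P = Q →
        h.choose = h'.choose := by
      rintro P _ h h' rfl
      rfl
    by_cases h : ∃ i, m.mark i = m.light z
    · have h' : ∃ i, (m.relabel π).mark i = (m.relabel π).light (π z) := by
        simpa only [hl, hm, π.injective.eq_iff] using h
      simp only [removeSide, CornerMap.relabel, dif_pos h, dif_pos h', Sum.map_inr, id]
      exact congrArg Sum.inr (hc _ _ h' h hP)
    · have h' : ¬ ∃ i, (m.relabel π).mark i = (m.relabel π).light (π z) := by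
        simpa only [hl, hm, π.injective.eq_iff] using h
      simp only [removeSide, CornerMap.relabel, dif_neg h, dif_neg h', Sum.map_inl, hl]

variable {s : ℕ} (O : EdgeOrientation)

theorem CornerMap.suppress_relabel (x : CornerMap E (Fin (s + 2))) :
    (x.relabel π).suppress O = (x.suppress O).relabel π := by
  have h0 : (x.relabel π).map.mark 0 = π (x.map.mark 0) := rfl
  have hγ : (x.relabel π).map.lightestGeodesic O.rev (π (x.map.mark 0)) (x.relabel π).cornerVertex
      = (x.map.lightestGeodesic O.rev (x.map.mark 0) x.cornerVertex).map π := by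
    rw [cornerVertex_relabel]
    exact PreHypermap.lightestGeodesic_relabel π x.map O.rev _ _
  have key : ∀ (m : PreHypermap E (Fin (s + 2))),
      (⟨(m.relabel π).light, (m.relabel π).dark, fun i => (m.relabel π).mark i.succ⟩ :
        PreHypermap E (Fin (s + 1))) =
      PreHypermap.relabel π ⟨m.light, m.dark, fun i => m.mark i.succ⟩ := fun _ => rfl
  simp only [suppress, h0, hγ, getLastD_map_perm, ← List.map_cons, slide_relabel,
    insertSide_relabel, key, PreHypermap.tail_relabel]
  rfl

theorem VertexEdgeMap.addFace_relabel (y : VertexEdgeMap E (Fin (s + 1))) :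
    (y.relabel π).addFace O = (y.addFace O).relabel π := by
  have h0 : ((y.map.relabel π).lightNext O)⁻¹ (π y.edge)
      = π ((y.map.lightNext O)⁻¹ y.edge) := by
    simp [PreHypermap.lightNext_relabel]
  have he : (y.relabel π).edge = π y.edge := rfl
  have hv : (y.relabel π).vertex = π '' y.vertex := rfl
  have hm : (y.relabel π).map = y.map.relabel π := rfl
  have key : ∀ (x : CornerMap E (Fin (s + 1))) (a : E),
      (⟨⟨(x.relabel π).map.light, (x.relabel π).map.dark, Fin.cons (π a) (x.relabel π).map.mark⟩,
        Sum.map id Fin.succ (x.relabel π).corner⟩ : CornerMap E (Fin (s + 2))) =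
      CornerMap.relabel π
        ⟨⟨x.map.light, x.map.dark, Fin.cons a x.map.mark⟩, Sum.map id Fin.succ x.corner⟩ := by
    intro x a
    ext1
    · ext1
      · rfl
      · rfl
      · ext i
        refine Fin.cases ?_ (fun j => ?_) i <;> rfl
    · rcases hc : x.corner <;> simp [CornerMap.relabel, hc]
  simp only [addFace, he, hv, hm, h0, PreHypermap.lightestGeodesic_relabel, headD_map_perm, getLastD_map_perm,
    PreHypermap.removeSide_relabel, CornerMap.slide_relabel, key]

end Relabel

/-! ### The maps between isomorphism classes -/

/-- Maps with a distinguished corner, up to isomorphism. -/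
abbrev CornerMapClass (E ι : Type*) : Type _ := Quotient (CornerMap.isoSetoid E ι)

/-- Maps with a distinguished vertex and a distinguished edge, up to isomorphism. -/
abbrev VertexEdgeMapClass (E ι : Type*) : Type _ := Quotient (VertexEdgeMap.isoSetoid E ι)

/-- The set of the plane `p`-hypermaps of type `a` with `n` edges (up to isomorphism), with a
distinguished corner in the face `f₂`. -/
def cornerMaps (p n : ℕ) {s : ℕ} (a : Fin (s + 2) → ℕ) :
    Set (CornerMapClass (Fin n) (Fin (s + 2))) :=
  {q | ∃ x : CornerMap (Fin n) (Fin (s + 2)), Quotient.mk _ x = q ∧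
    x.map.IsHypermap p ∧ x.map.HasType a ∧ x.CornerInFace 1}

/-- The set of the plane `p`-hypermaps of type `a` with `n` edges (up to isomorphism), with a
distinguished vertex and a distinguished edge that is incident to the face `f̃₂` and
that leaves the distinguished vertex for the orientation reverse to `O`. -/
def vertexEdgeMaps (p n : ℕ) (O : EdgeOrientation) {s : ℕ} (a : Fin (s + 1) → ℕ) :
    Set (VertexEdgeMapClass (Fin n) (Fin (s + 1))) :=
  {q | ∃ y : VertexEdgeMap (Fin n) (Fin (s + 1)), Quotient.mk _ y = q ∧
    y.map.IsHypermap p ∧ y.map.HasType a ∧ y.vertex ∈ Set.range y.map.vertexOf ∧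
    y.edge ∈ y.map.lightFace (y.map.mark 0) ∧ y.map.IsLeaving O.rev y.vertex y.edge}

/-- The map `Ψ₋`, which suppresses the face `f₁`, on isomorphism classes. -/
noncomputable def psiMinus {E : Type*} [DecidableEq E] {s : ℕ} (O : EdgeOrientation) :
    CornerMapClass E (Fin (s + 2)) → VertexEdgeMapClass E (Fin (s + 1)) :=
  Quotient.map (sa := CornerMap.isoSetoid E _) (sb := VertexEdgeMap.isoSetoid E _)
    (CornerMap.suppress O) (by
      rintro x _ ⟨π, rfl⟩
      exact ⟨π, (x.suppress_relabel π O).symm⟩)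

/-- The map `Ψ₊`, which adds a face `f₁`, on isomorphism classes. -/
noncomputable def psiPlus {E : Type*} [DecidableEq E] {s : ℕ} (O : EdgeOrientation) :
    VertexEdgeMapClass E (Fin (s + 1)) → CornerMapClass E (Fin (s + 2)) :=
  Quotient.map (sa := VertexEdgeMap.isoSetoid E _) (sb := CornerMap.isoSetoid E _)
    (VertexEdgeMap.addFace O) (by
      rintro y _ ⟨π, rfl⟩
      exact ⟨π, (y.addFace_relabel π O).symm⟩)

/-! Label each vertex by its directed distance to the target of the geodesic `e 0, …, e k`. Labels
drop by at most one along any edge, and by exactly one along the geodesic edges after a loop or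
distinguished edge `e 0`. At the end of each `e i` the geodesic cuts out a sector: the outgoing
edges passed while turning before the next step is taken. Sewing the light side of `e (i + 1)` onto
the dark side of `e i` moves the sector at the end of `e i` to the new origin of `e i`, one unit
farther from the target. So the labels raised by one on the sectors (`raise`) are again a function
of the vertices of the new map. Because each step is the first one going closer, a sector edge does
not go closer, and the raised labels still drop by at most one along every edge.

This has two consequences in the new map. The path `e 0, …, e k` is geodesic from the origin of `e
0`. The edges met when turning the other way from `e (i + 1)`, before `e i`, have origins whose
label is too small for them to be closer to that origin. Hence the lightest geodesic of the reverse
orientation runs back along the same path, and the slide along the reversed list undoes the first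
one. `IsFirstDescent.isSewn` treats both operations at once; they differ by their first edge and by
the last sector, which stops at the distinguished corner when suppressing a face and is the whole
last vertex when adding one. `Connected.isSewn_dist` and `Connected.isSewn_lightestEdge` draw the
consequences.

The resulting map is a hypermap of the right type for the following reasons. Dark contours do not
change. Light contours change by a relabelling and the insertion of one side (`IsInsertion`).
Connectivity passes through (`Connected.of_isSewn`). Suppression loses one light face and gains one
vertex (`IsSuppressPath.ncard_range_cycleSet`), so the Euler relation is kept; for the addition, the
same count is applied to the map obtained, whose suppression is the initial map. Since an edge keeps
the name of its dark side, both composites are identities already on labelled maps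
(`CornerMap.suppress_spec`, `VertexEdgeMap.addFace_spec`). -/

theorem Equiv.Perm.apply_inv_apply {α : Type*} (f : Equiv.Perm α) (x : α) : f (f⁻¹ x) = x :=
  f.apply_symm_apply x

theorem Equiv.Perm.inv_apply_apply {α : Type*} (f : Equiv.Perm α) (x : α) : f⁻¹ (f x) = x :=
  f.symm_apply_apply x

theorem Equiv.Perm.SameCycle.map_eq {α β : Type*} {g : Equiv.Perm α} {F : α → β}
    (hF : ∀ x, F (g x) = F x) {x y : α} (h : g.SameCycle x y) : F x = F y := by
  have hpow : ∀ (j : ℕ) x, F ((g ^ j) x) = F x := by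
    intro j
    induction j with
    | zero => simp
    | succ j ih => intro x; rw [pow_succ', Equiv.Perm.mul_apply, hF, ih]
  obtain ⟨i, rfl⟩ := h
  cases i with
  | ofNat i => exact (hpow i x).symm
  | negSucc i =>
    rw [zpow_negSucc, ← hpow (i + 1) (((g ^ (i + 1))⁻¹) x), Equiv.Perm.apply_inv_apply]

/-! ### Rotation around vertices, directed paths and distances. -/

namespace PreHypermap

variable {E ι : Type*} (m : PreHypermap E ι) (O : EdgeOrientation)

/-- The rotation of the edges starting from each vertex in the orientation `O`, in the direction
used by `turn`. -/
def rot : Equiv.Perm E := m.lightNext O * (m.darkNext O)⁻¹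

theorem sameCycle_vertexPerm_iff (e e' : E) :
    m.vertexOf e = m.vertexOf e' ↔ (m.dark * m.light⁻¹).SameCycle e e' := by
  constructor
  · intro h
    have : e' ∈ m.vertexOf e' := Equiv.Perm.SameCycle.refl _ _
    rw [← h] at this
    exact this
  · intro h
    ext x
    exact ⟨fun hx => h.symm.trans hx, fun hx => h.trans hx⟩

theorem tail_eq_tail_iff {e e' : E} :
    m.tail O e = m.tail O e' ↔ (m.rot O).SameCycle e e' := by
  cases O
  · have : m.rot .lightLeft = (m.dark * m.light⁻¹)⁻¹ := by simp [rot, lightNext, darkNext]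
    rw [this, Equiv.Perm.sameCycle_inv]
    exact m.sameCycle_vertexPerm_iff e e'
  · have : m.rot .lightRight = m.light⁻¹ * (m.dark * m.light⁻¹) * m.light⁻¹⁻¹ := by
      simp [rot, lightNext, darkNext, mul_assoc]
    rw [this, Equiv.Perm.sameCycle_conj]
    simpa [tail] using m.sameCycle_vertexPerm_iff (m.light e) (m.light e')

theorem head_eq_tail_lightNext (e : E) : m.head O e = m.tail O (m.lightNext O e) := by
  cases O <;> simp [head, tail, lightNext]

theorem rot_darkNext (e : E) : m.rot O (m.darkNext O e) = m.lightNext O e := by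
  simp [rot]

theorem tail_rot (e : E) : m.tail O (m.rot O e) = m.tail O e :=
  (m.tail_eq_tail_iff O).2 (by simp [Equiv.Perm.SameCycle.refl])

theorem tail_rot_pow (j : ℕ) (e : E) : m.tail O ((m.rot O ^ j) e) = m.tail O e :=
  (m.tail_eq_tail_iff O).2 (by simp [Equiv.Perm.SameCycle.refl])

theorem head_eq_tail_darkNext (e : E) : m.head O e = m.tail O (m.darkNext O e) := by
  rw [head_eq_tail_lightNext, ← rot_darkNext, tail_rot]

theorem tail_rev (e : E) : m.tail O.rev e = m.head O e := by cases O <;> rfl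

theorem head_rev (e : E) : m.head O.rev e = m.tail O e := by cases O <;> rfl

theorem lightNext_rev : m.lightNext O.rev = (m.lightNext O)⁻¹ := by
  cases O <;> simp [lightNext, EdgeOrientation.rev]

theorem darkNext_rev : m.darkNext O.rev = (m.darkNext O)⁻¹ := by
  cases O <;> simp [darkNext, EdgeOrientation.rev]

theorem _root_.EdgeOrientation.rev_rev : O.rev.rev = O := by cases O <;> rfl

theorem turn_eq (e : E) (i : ℕ) : m.turn O e i = (m.rot O ^ i) (m.lightNext O e) := rfl

variable {m O}

theorem IsPath.append {u v w : Set E} {l l' : List E} (h : m.IsPath O u l v)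
    (h' : m.IsPath O v l' w) : m.IsPath O u (l ++ l') w := by
  induction l generalizing u with
  | nil => cases h; exact h'
  | cons e l ih => exact ⟨h.1, ih h.2⟩

theorem IsPath.reverse {v w : Set E} {l : List E} (h : m.IsPath O v l w) :
    m.IsPath O.rev w l.reverse v := by
  induction l generalizing v with
  | nil => exact h.symm
  | cons e l ih =>
    rw [List.reverse_cons]
    exact (ih h.2).append ⟨m.tail_rev O e, (m.head_rev O e).trans h.1⟩

theorem dist_rev (v w : Set E) : m.dist O.rev v w = m.dist O w v := by
  unfold dist
  congr 1
  ext k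
  constructor
  · rintro ⟨l, rfl, h⟩
    exact ⟨l.reverse, by simp, by simpa [EdgeOrientation.rev_rev] using h.reverse⟩
  · rintro ⟨l, rfl, h⟩
    exact ⟨l.reverse, by simp, h.reverse⟩

theorem dist_le_length {v w : Set E} {l : List E} (h : m.IsPath O v l w) :
    m.dist O v w ≤ l.length := Nat.sInf_le ⟨l, rfl, h⟩

/-- A function of the vertices, seen as a function of the edges through their origins,
decreases at most by one along each edge of a path. -/
theorem IsPath.le_add_length {h : E → ℕ}
    (h₁ : ∀ y, h (m.lightNext O y) = h (m.darkNext O y))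
    (h₂ : ∀ y, h y ≤ h (m.darkNext O y) + 1) {a b : E} {l : List E}
    (hl : m.IsPath O (m.tail O a) l (m.tail O b)) : h a ≤ h b + l.length := by
  have hrot : ∀ y, h (m.rot O y) = h y := fun y => by
    have := h₁ ((m.darkNext O)⁻¹ y)
    simpa [rot] using this
  have hcyc : ∀ y y', m.tail O y = m.tail O y' → h y = h y' := fun y y' e =>
    ((m.tail_eq_tail_iff O).1 e).map_eq hrot
  induction l generalizing a with
  | nil => exact (hcyc a b hl).le
  | cons e l ih =>
    obtain ⟨he, hl⟩ := hl
    rw [head_eq_tail_darkNext] at hl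
    have := ih hl
    have := h₂ e
    have := hcyc e a he
    simp only [List.length_cons]
    omega

variable (m O)

/-- The group generated by the contour permutations is transitive. -/
def Connected : Prop := ∀ e e' : E, ∃ g ∈ Subgroup.closure {m.light, m.dark}, g e = e'

/-- Stability of an equivalence relation is insensitive to inverting a permutation, so this form of
transitivity serves both orientations and is easy to transfer from one map to another. -/
theorem connected_iff : m.Connected ↔ ∀ r : Setoid E, (∀ y, r y (m.lightNext O y)) →
    (∀ y, r y (m.darkNext O y)) → ∀ y y', r y y' := by
  constructor
  · intro h r h₁ h₂ y y'
    have h₁' : ∀ y, r y (m.light y) := by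
      cases O
      · exact h₁
      · intro y
        have := h₁ (m.light y)
        simp only [lightNext, Equiv.Perm.inv_apply_apply] at this
        exact r.symm this
    have h₂' : ∀ y, r y (m.dark y) := by
      cases O
      · exact h₂
      · intro y
        have := h₂ (m.dark y)
        simp only [darkNext, Equiv.Perm.inv_apply_apply] at this
        exact r.symm this
    obtain ⟨g, hg, rfl⟩ := h y y'
    induction hg using Subgroup.closure_induction generalizing y with
    | mem g hg =>
      rcases hg with rfl | rfl
      · exact h₁' y
      · exact h₂' y
    | one => exact r.refl y
    | mul g g' _ _ ih ih' => exact r.trans (ih' y) (ih (g' y))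
    | inv g _ ih =>
      have := ih (g⁻¹ y)
      rw [Equiv.Perm.apply_inv_apply] at this
      exact r.symm this
  · intro h
    let r : Setoid E :=
      { r := fun e e' => ∃ g ∈ Subgroup.closure {m.light, m.dark}, g e = e'
        iseqv := by
          refine ⟨fun e => ⟨1, one_mem _, rfl⟩, ?_, ?_⟩
          · rintro e _ ⟨g, hg, rfl⟩
            exact ⟨g⁻¹, inv_mem hg, by simp⟩
          · rintro e _ _ ⟨g, hg, rfl⟩ ⟨g', hg', rfl⟩
            exact ⟨g' * g, mul_mem hg' hg, rfl⟩ }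
    have hl : m.light ∈ Subgroup.closure {m.light, m.dark} := Subgroup.subset_closure (by simp)
    have hd : m.dark ∈ Subgroup.closure {m.light, m.dark} := Subgroup.subset_closure (by simp)
    refine h r (fun y => ⟨m.lightNext O, ?_, rfl⟩) (fun y => ⟨m.darkNext O, ?_, rfl⟩)
    · cases O
      exacts [hl, inv_mem hl]
    · cases O
      exacts [hd, inv_mem hd]

variable {m}

/-- An edge can be travelled backwards by going round its finite light contour. Mutual reachability
by directed paths is therefore an equivalence relation stable under both contour permutations. -/
theorem Connected.exists_isPath [Finite E] (hm : m.Connected) (e e' : E) :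
    ∃ l, m.IsPath O (m.tail O e) l (m.tail O e') := by
  have htrans : ∀ {a b c : E}, (∃ l, m.IsPath O (m.tail O a) l (m.tail O b)) →
      (∃ l, m.IsPath O (m.tail O b) l (m.tail O c)) →
      ∃ l, m.IsPath O (m.tail O a) l (m.tail O c) := by
    rintro a b c ⟨l, hl⟩ ⟨l', hl'⟩
    exact ⟨_, hl.append hl'⟩
  have h₁ : ∀ y, ∃ l, m.IsPath O (m.tail O y) l (m.tail O (m.lightNext O y)) := fun y =>
    ⟨[y], rfl, m.head_eq_tail_lightNext O y⟩
  have hpow : ∀ (j : ℕ) y, ∃ l, m.IsPath O (m.tail O y) l (m.tail O ((m.lightNext O ^ j) y)) := by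
    intro j
    induction j with
    | zero => exact fun y => ⟨[], rfl⟩
    | succ j ih => intro y; rw [pow_succ', Equiv.Perm.mul_apply]; exact htrans (ih y) (h₁ _)
  have h₂ : ∀ y, ∃ l, m.IsPath O (m.tail O (m.lightNext O y)) l (m.tail O y) := fun y => by
    have hc : (m.lightNext O).SameCycle (m.lightNext O y) y := by
      simp [Equiv.Perm.SameCycle.refl]
    obtain ⟨j, _, hj⟩ := hc.exists_pow_eq''
    have := hpow j (m.lightNext O y)
    rwa [hj.2] at this
  have hd : ∀ y, m.tail O (m.darkNext O y) = m.tail O (m.lightNext O y) := fun y => by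
    rw [← head_eq_tail_darkNext, head_eq_tail_lightNext]
  let r : Setoid E :=
    { r := fun a b => (∃ l, m.IsPath O (m.tail O a) l (m.tail O b)) ∧
        ∃ l, m.IsPath O (m.tail O b) l (m.tail O a)
      iseqv := ⟨fun a => ⟨⟨[], rfl⟩, ⟨[], rfl⟩⟩, fun h => ⟨h.2, h.1⟩,
        fun h h' => ⟨htrans h.1 h'.1, htrans h'.2 h.2⟩⟩ }
  exact ((m.connected_iff O).1 hm r (fun y => ⟨h₁ y, h₂ y⟩)
    (fun y => by
      change (∃ l, _) ∧ ∃ l, _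
      rw [hd]
      exact ⟨h₁ y, h₂ y⟩) e e').1

variable {O}

theorem Connected.exists_isPath_dist [Finite E] (hm : m.Connected) (e e' : E) :
    ∃ l, l.length = m.dist O (m.tail O e) (m.tail O e') ∧
      m.IsPath O (m.tail O e) l (m.tail O e') := by
  obtain ⟨l, hl⟩ := hm.exists_isPath O e e'
  exact Nat.sInf_mem (s := {k | ∃ l : List E, l.length = k ∧
    m.IsPath O (m.tail O e) l (m.tail O e')}) ⟨_, l, rfl, hl⟩

theorem Connected.tail_eq_of_dist_eq_zero [Finite E] (hm : m.Connected) {e e' : E}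
    (h : m.dist O (m.tail O e) (m.tail O e') = 0) : m.tail O e = m.tail O e' := by
  obtain ⟨l, hl, hp⟩ := hm.exists_isPath_dist (O := O) e e'
  rw [h, List.length_eq_zero_iff] at hl
  subst hl
  exact hp

theorem dist_self (v : Set E) : m.dist O v v = 0 :=
  Nat.le_zero.1 (dist_le_length (l := []) rfl)

theorem Connected.dist_le_add_one [Finite E] (hm : m.Connected) (e e' : E) :
    m.dist O (m.tail O e) (m.tail O e')
      ≤ m.dist O (m.tail O (m.lightNext O e)) (m.tail O e') + 1 := by
  obtain ⟨l, hl, hp⟩ := hm.exists_isPath_dist (O := O) (m.lightNext O e) e'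
  rw [← hl]
  exact dist_le_length (l := e :: l) ⟨rfl, by rwa [head_eq_tail_lightNext]⟩

theorem Connected.exists_closer [Finite E] (hm : m.Connected) {e e' : E}
    (h : 0 < m.dist O (m.tail O e) (m.tail O e')) :
    ∃ y, m.tail O y = m.tail O e ∧ m.dist O (m.tail O (m.lightNext O y)) (m.tail O e') + 1
      = m.dist O (m.tail O e) (m.tail O e') := by
  obtain ⟨l, hl, hp⟩ := hm.exists_isPath_dist (O := O) e e'
  cases l with
  | nil => simp at hl; omega
  | cons y l =>
    obtain ⟨hy, hp⟩ := hp
    rw [head_eq_tail_lightNext] at hp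
    refine ⟨y, hy, le_antisymm ?_ ?_⟩
    · have := dist_le_length hp
      simp only [List.length_cons] at hl
      omega
    · rw [← hy]
      exact hm.dist_le_add_one y e'

/-- The source of all lower bounds on distances in a sewn map: any function of the vertices that
drops by at most one per edge will do. -/
theorem Connected.le_dist_add [Finite E] (hm : m.Connected) {h : E → ℕ}
    (h₁ : ∀ y, h (m.lightNext O y) = h (m.darkNext O y))
    (h₂ : ∀ y, h y ≤ h (m.darkNext O y) + 1) (a b : E) :
    h a ≤ h b + m.dist O (m.tail O a) (m.tail O b) := by
  obtain ⟨l, hl, hp⟩ := hm.exists_isPath_dist (O := O) a b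
  rw [← hl]
  exact hp.le_add_length h₁ h₂

/-- The lightest edge after `e` is the first edge going closer to the target. -/
theorem Connected.lightestEdge_spec [Finite E] (hm : m.Connected) {e t : E}
    (h : 0 < m.dist O (m.tail O (m.lightNext O e)) (m.tail O t)) :
    ∃ n, m.lightestEdge O (m.tail O t) e = (m.rot O ^ n) (m.lightNext O e) ∧
      m.dist O (m.tail O (m.lightNext O (m.lightestEdge O (m.tail O t) e))) (m.tail O t) + 1
        = m.dist O (m.tail O (m.lightNext O e)) (m.tail O t) ∧
      ∀ j < n, m.dist O (m.tail O (m.lightNext O ((m.rot O ^ j) (m.lightNext O e))))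
        (m.tail O t) + 1 ≠ m.dist O (m.tail O (m.lightNext O e)) (m.tail O t) := by
  set s : Set ℕ := {i | m.dist O (m.head O (m.turn O e i)) (m.tail O t) + 1
    = m.dist O (m.head O e) (m.tail O t)} with hs
  have hne : s.Nonempty := by
    obtain ⟨y, hy, hd⟩ := hm.exists_closer h
    obtain ⟨j, _, hj⟩ := ((m.tail_eq_tail_iff O).1 hy.symm).exists_pow_eq''
    refine ⟨j, ?_⟩
    simp only [hs, Set.mem_ofPred_eq, turn_eq, head_eq_tail_lightNext, hj.2]
    exact hd
  refine ⟨sInf s, rfl, ?_, fun j hj hj' => ?_⟩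
  · rw [← head_eq_tail_lightNext, ← head_eq_tail_lightNext]
    exact Nat.sInf_mem hne
  · refine Nat.notMem_of_lt_sInf hj ?_
    simp only [hs, Set.mem_ofPred_eq, turn_eq, head_eq_tail_lightNext]
    exact hj'

end PreHypermap

/-! ### Sewing back the sides of a slit -/

section Sewing

variable {E : Type*}

/-- A path `e 1, …, e k` that arrives at a vertex with label `0`, in which labels decrease by one
at each step, and which starts from the end of the edge `e 0`. The edge `e (i + 1)` is obtained
from the end of `e i` by `n i` turns around the current vertex, and it is the first edge
whose end has a smaller label. -/
structure IsFirstDescent (l d : Equiv.Perm E) (f : E → ℕ) (e : ℕ → E) (n : ℕ → ℕ) (k : ℕ) :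
    Prop where
  label_eq : ∀ y, f (l y) = f (d y)
  label_le : ∀ y, f y ≤ f (l y) + 1
  label_end : ∀ i ≤ k, f (l (e i)) + i = k
  step : ∀ i < k, ((l * d⁻¹) ^ n i) (l (e i)) = e (i + 1)
  first : ∀ i < k, ∀ j < n i, f (l (((l * d⁻¹) ^ j) (l (e i)))) + 1 ≠ f (l (e i))

/-- The edges met before leaving while turning around the vertices of a path. -/
def sector (l d : Equiv.Perm E) (e : ℕ → E) (n : ℕ → ℕ) (k : ℕ) : Set E :=
  {x | ∃ i ≤ k, ∃ j < n i, ((l * d⁻¹) ^ j) (l (e i)) = x}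

open Classical in
/-- The function `f` increased by one on the set `W`. -/
noncomputable def raise (f : E → ℕ) (W : Set E) (x : E) : ℕ := f x + if x ∈ W then 1 else 0

theorem raise_of_mem {f : E → ℕ} {W : Set E} {x : E} (h : x ∈ W) : raise f W x = f x + 1 := by
  simp [raise, h]

theorem raise_of_notMem {f : E → ℕ} {W : Set E} {x : E} (h : x ∉ W) : raise f W x = f x := by
  simp [raise, h]

/-- `σ` permutes `e 0, …, e k` cyclically and fixes everything else. -/
structure IsShift (σ : Equiv.Perm E) (e : ℕ → E) (k : ℕ) : Prop where
  apply_lt : ∀ i < k, σ (e i) = e (i + 1)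
  apply_last : σ (e k) = e 0
  apply_of_ne : ∀ x, (∀ i ≤ k, x ≠ e i) → σ x = x

theorem IsShift.inv_succ {σ : Equiv.Perm E} {e : ℕ → E} {k i : ℕ} (h : IsShift σ e k)
    (hi : i < k) : σ⁻¹ (e (i + 1)) = e i := by
  rw [← h.apply_lt i hi, Equiv.Perm.inv_apply_apply]

theorem IsShift.inv_zero {σ : Equiv.Perm E} {e : ℕ → E} {k : ℕ} (h : IsShift σ e k) :
    σ⁻¹ (e 0) = e k := by
  rw [← h.apply_last, Equiv.Perm.inv_apply_apply]

theorem IsShift.inv_of_ne {σ : Equiv.Perm E} {e : ℕ → E} {k : ℕ} (h : IsShift σ e k) {x : E}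
    (hx : ∀ i ≤ k, x ≠ e i) : σ⁻¹ x = x := by
  conv_lhs => rw [← h.apply_of_ne x hx, Equiv.Perm.inv_apply_apply]

/-- After a sewing with new contour permutation `l'`, the path `e 0, …, e k` climbs down the labels
`h`, and one finds it back by turning in the opposite direction. -/
structure IsSewn (l' d : Equiv.Perm E) (h : E → ℕ) (e : ℕ → E) (n : ℕ → ℕ) (k : ℕ) : Prop where
  label_eq : ∀ y, h (l' y) = h (d y)
  label_le : ∀ y, h y ≤ h (d y) + 1
  label_path : ∀ i ≤ k, h (e i) + i = k + 1
  back : ∀ i < k, ((l' * d⁻¹) ^ (n (i + 1) + 1)) (d (e i)) = e (i + 1)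
  back_first : ∀ i < k, ∀ j < n (i + 1),
    h (d⁻¹ (((l' * d⁻¹) ^ (j + 1)) (d (e i)))) + i ≤ k

namespace IsFirstDescent

variable {l d : Equiv.Perm E} {f : E → ℕ} {e : ℕ → E} {n : ℕ → ℕ} {k : ℕ}

section

variable (H : IsFirstDescent l d f e n k)
include H

theorem label_turn (x : E) : f ((l * d⁻¹) x) = f x := by
  have := H.label_eq (d⁻¹ x)
  rwa [Equiv.Perm.apply_inv_apply] at this

theorem label_turn_pow (j : ℕ) (x : E) : f (((l * d⁻¹) ^ j) x) = f x := by
  induction j with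
  | zero => rfl
  | succ j ih => rw [pow_succ', Equiv.Perm.mul_apply, H.label_turn, ih]

theorem label_sector {i j : ℕ} (hi : i ≤ k) : f (((l * d⁻¹) ^ j) (l (e i))) + i = k := by
  rw [H.label_turn_pow, H.label_end i hi]

theorem label_succ {i : ℕ} (hi : i < k) : f (e (i + 1)) + i = k := by
  rw [← H.step i hi, H.label_sector hi.le]

/-- Labels leave only the sector number `i` as a candidate, and `e (i + 1)` goes closer to the
target whereas the edges of that sector do not. -/
theorem succ_notMem {i : ℕ} (hi : i < k) : e (i + 1) ∉ sector l d e n k := by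
  rintro ⟨i', hi', j, hj, h⟩
  have h₁ := H.label_succ hi
  have h₂ := H.label_sector (j := j) hi'
  rw [h] at h₂
  obtain rfl : i' = i := by omega
  have h₃ := H.first i' hi j hj
  rw [h] at h₃
  have h₄ := H.label_end (i' + 1) hi
  have h₅ := H.label_end i' hi.le
  omega

/-- The edge `d (e i)` is the last one met in a full turn starting from `l (e i)`. If it were in the
sector, the sector would exhaust the vertex and contain the edge `b` on which it is supposed to
stop. -/
theorem dark_notMem_of {i : ℕ} (hi : i ≤ k) {b : E}
    (hb : ((l * d⁻¹) ^ n i) (l (e i)) = b) (hb' : b ∉ sector l d e n k) :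
    d (e i) ∉ sector l d e n k := by
  rintro ⟨i', hi', j, hj, h⟩
  have h₁ := H.label_sector (j := j) hi'
  rw [h, ← H.label_eq] at h₁
  have h₂ := H.label_end i hi
  obtain rfl : i' = i := by omega
  have h₃ : ((l * d⁻¹) ^ (j + 1)) (l (e i')) = l (e i') := by
    rw [pow_succ', Equiv.Perm.mul_apply, h, Equiv.Perm.mul_apply, Equiv.Perm.inv_apply_apply]
  refine hb' ⟨i', hi', n i' - (j + 1), by omega, ?_⟩
  rw [← hb]
  conv_rhs => rw [show n i' = n i' - (j + 1) + (j + 1) by omega, pow_add, Equiv.Perm.mul_apply, h₃]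

theorem dark_notMem {i : ℕ} (hi : i < k) : d (e i) ∉ sector l d e n k :=
  H.dark_notMem_of hi.le (H.step i hi) (H.succ_notMem hi)

/-- A sector edge precedes the first edge going closer; in the last sector the label is already `0`.
This is what leaves room for raising the label of its origin. -/
theorem label_le_of_mem {x : E} (hx : x ∈ sector l d e n k) : f x ≤ f (l x) := by
  obtain ⟨i, hi, j, hj, rfl⟩ := hx
  have h₁ := H.label_sector (j := j) hi
  rcases hi.lt_or_eq with hi' | rfl
  · have h₂ := H.first i hi' j hj
    have h₃ := H.label_le (((l * d⁻¹) ^ j) (l (e i)))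
    have h₄ := H.label_end i hi
    omega
  · omega

theorem raise_le_label_add_one (y : E) : raise f (sector l d e n k) y ≤ f (l y) + 1 := by
  by_cases hy : y ∈ sector l d e n k
  · rw [raise_of_mem hy]
    have := H.label_le_of_mem hy
    omega
  · rw [raise_of_notMem hy]
    exact H.label_le y

theorem raise_le_dark (y : E) :
    raise f (sector l d e n k) y ≤ raise f (sector l d e n k) (d y) + 1 := by
  have h₁ := H.raise_le_label_add_one y
  rw [H.label_eq] at h₁
  unfold raise at h₁ ⊢
  omega

theorem raise_succ {i : ℕ} (hi : i < k) :
    raise f (sector l d e n k) (e (i + 1)) + (i + 1) = k + 1 := by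
  rw [raise_of_notMem (H.succ_notMem hi)]
  have := H.label_succ hi
  omega

theorem raise_sector {i j : ℕ} (hi : i ≤ k) (hj : j < n i) :
    raise f (sector l d e n k) (((l * d⁻¹) ^ j) (l (e i))) + i = k + 1 := by
  have hW : ((l * d⁻¹) ^ j) (l (e i)) ∈ sector l d e n k := ⟨i, hi, j, hj, rfl⟩
  rw [raise_of_mem hW]
  have := H.label_sector (j := j) hi
  omega

omit H in
-- The light predecessor of an edge of a sector, or of the edge that closes it, is either a path
-- edge or an edge whose dark successor is in the sector. All other edges keep their light successor
-- away from the places modified by the sewing.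
theorem light_ne {y : E} (hy : ∀ i ≤ k, y ≠ e i) (hd : d y ∉ sector l d e n k) {i j : ℕ}
    (hi : i ≤ k) (hj : j ≤ n i) : l y ≠ ((l * d⁻¹) ^ j) (l (e i)) := by
  intro h
  cases j with
  | zero => exact hy i hi (l.injective h)
  | succ j =>
    refine hd ⟨i, hi, j, hj, ?_⟩
    apply (l * d⁻¹).injective
    rw [pow_succ', Equiv.Perm.mul_apply] at h
    rw [← h, Equiv.Perm.mul_apply, Equiv.Perm.inv_apply_apply]

theorem light_ne_succ {y : E} (hy : ∀ i ≤ k, y ≠ e i) (hd : d y ∉ sector l d e n k) {i : ℕ}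
    (hi : i < k) : l y ≠ e (i + 1) := by
  rw [← H.step i hi]
  exact light_ne hy hd hi.le le_rfl

omit H in
theorem light_notMem {y : E} (hy : ∀ i ≤ k, y ≠ e i) (hd : d y ∉ sector l d e n k) :
    l y ∉ sector l d e n k := by
  rintro ⟨i, hi, j, hj, h⟩
  exact light_ne hy hd hi hj.le h.symm

/-- The properties of a sewing, deduced from the way one turns around the new vertices. -/
theorem isSewn {l' : Equiv.Perm E} (h0 : raise f (sector l d e n k) (e 0) = k + 1)
    (advance : ∀ i ≤ k, ∀ j < n i, l' (d⁻¹ (((l * d⁻¹) ^ j) (l (e i))))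
      = if j + 1 < n i then ((l * d⁻¹) ^ (j + 1)) (l (e i)) else e i)
    (start : ∀ i < k, l' (e i) = if 0 < n (i + 1) then l (e (i + 1)) else e (i + 1))
    (last : d (e k) ∉ sector l d e n k →
      raise f (sector l d e n k) (l' (e k)) = raise f (sector l d e n k) (d (e k)))
    (other : ∀ y, (∀ i ≤ k, y ≠ e i) → d y ∉ sector l d e n k →
      raise f (sector l d e n k) (l' y) = f (d y)) :
    IsSewn l' d (raise f (sector l d e n k)) e n k := by
  have hpath : ∀ i ≤ k, raise f (sector l d e n k) (e i) + i = k + 1 := by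
    intro i hi
    cases i with
    | zero => exact h0
    | succ i => exact H.raise_succ hi
  -- Around the new origin of `e (i + 1)`, the edge `d (e i)` is followed by the whole sector number
  -- `i + 1` and then by `e (i + 1)`, which makes `n (i + 1) + 1` turns.
  have hback : ∀ i < k, ∀ j ≤ n (i + 1), ((l' * d⁻¹) ^ (j + 1)) (d (e i))
      = if j < n (i + 1) then ((l * d⁻¹) ^ j) (l (e (i + 1))) else e (i + 1) := by
    intro i hi j
    induction j with
    | zero =>
      intro _
      rw [zero_add, pow_one, Equiv.Perm.mul_apply, Equiv.Perm.inv_apply_apply, start i hi]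
      rfl
    | succ j ih =>
      intro hj
      rw [pow_succ', Equiv.Perm.mul_apply, ih (by omega), if_pos (by omega),
        Equiv.Perm.mul_apply, advance (i + 1) hi j hj]
  refine ⟨fun y => ?_, H.raise_le_dark, hpath, fun i hi => ?_, fun i hi j hj => ?_⟩
  · by_cases hd : d y ∈ sector l d e n k
    · obtain ⟨i, hi, j, hj, h⟩ := hd
      have h₁ := advance i hi j hj
      have h₂ := H.raise_sector hi hj
      rw [h] at h₁ h₂
      rw [Equiv.Perm.inv_apply_apply] at h₁
      -- From a sector edge the new rotation leads to the next edge of the sector or to `e i`, and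
      -- both have raised label `k + 1 - i`.
      have h₃ : raise f (sector l d e n k) (l' y) + i = k + 1 := by
        rw [h₁]
        split_ifs with hj'
        · exact H.raise_sector hi hj'
        · exact hpath i hi
      omega
    · by_cases hy : ∀ i ≤ k, y ≠ e i
      · rw [other y hy hd, raise_of_notMem hd]
      · push Not at hy
        obtain ⟨i, hi, rfl⟩ := hy
        rcases hi.lt_or_eq with hi' | rfl
        · rw [raise_of_notMem hd, ← H.label_eq, start i hi']
          have h₁ := H.label_end i hi
          have h₂ := hpath (i + 1) hi'
          split_ifs with hn
          · have h₃ := H.raise_sector (i := i + 1) hi' hn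
            rw [pow_zero, Equiv.Perm.one_apply] at h₃
            omega
          · omega
        · exact last hd
  · rw [hback i hi _ le_rfl, if_neg (lt_irrefl _)]
  · rw [hback i hi j hj.le, if_pos hj]
    -- The edge considered here ends at the vertex of the sector number `i + 1`, whose old label is
    -- `k - (i + 1)`; its own raised label is thus at most `k - i`.
    have h₁ := H.raise_le_label_add_one (d⁻¹ (((l * d⁻¹) ^ j) (l (e (i + 1)))))
    have h₂ := H.label_sector (i := i + 1) (j := j + 1) hi
    rw [pow_succ', Equiv.Perm.mul_apply, Equiv.Perm.mul_apply] at h₂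
    omega

end

variable [DecidableEq E] {σ : Equiv.Perm E} {b : E}

theorem sew_apply (hσ : IsShift σ e k) {y : E} (hy : ∀ i ≤ k, y ≠ e i) (h₀ : l y ≠ e 0)
    (hb : l y ≠ b) : (σ⁻¹ * Equiv.swap (e 0) b * l * σ) y = σ⁻¹ (l y) := by
  simp only [Equiv.Perm.mul_apply]
  rw [hσ.apply_of_ne y hy, Equiv.swap_apply_of_ne_of_ne h₀ hb]

theorem sew_apply_lt (hσ : IsShift σ e k) {i : ℕ} (hi : i < k) (h₀ : l (e (i + 1)) ≠ e 0)
    (hb : l (e (i + 1)) ≠ b) :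
    (σ⁻¹ * Equiv.swap (e 0) b * l * σ) (e i) = σ⁻¹ (l (e (i + 1))) := by
  simp only [Equiv.Perm.mul_apply]
  rw [hσ.apply_lt i hi, Equiv.swap_apply_of_ne_of_ne h₀ hb]

end IsFirstDescent

/-- The path used for suppressing a face of degree one, which is bounded by `e 0`; the
corner preceding the edge `b` is the distinguished corner. -/
structure IsSuppressPath (l d : Equiv.Perm E) (f : E → ℕ) (e : ℕ → E) (n : ℕ → ℕ) (k : ℕ) (b : E) :
    Prop extends IsFirstDescent l d f e n k where
  loop : l (e 0) = e 0
  corner_ne : b ≠ e 0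
  label_corner : f b = 0
  step_last : ((l * d⁻¹) ^ n k) (l (e k)) = b
  first_last : ∀ j < n k, ((l * d⁻¹) ^ j) (l (e k)) ≠ b

namespace IsSuppressPath

variable {l d : Equiv.Perm E} {f : E → ℕ} {e : ℕ → E} {n : ℕ → ℕ} {k : ℕ} {b : E}

section

variable (H : IsSuppressPath l d f e n k b)
include H

theorem corner_notMem : b ∉ sector l d e n k := by
  rintro ⟨i, hi, j, hj, h⟩
  have h₁ := H.label_sector (j := j) hi
  rw [h, H.label_corner] at h₁
  obtain rfl : i = k := by omega
  exact H.first_last j hj h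

theorem dark_notMem {i : ℕ} (hi : i ≤ k) : d (e i) ∉ sector l d e n k := by
  rcases hi.lt_or_eq with hi' | rfl
  · exact H.toIsFirstDescent.dark_notMem hi'
  · exact H.dark_notMem_of le_rfl H.step_last H.corner_notMem

theorem succ_ne_corner {i : ℕ} (hi : i < k) : e (i + 1) ≠ b := by
  intro h
  have := H.label_succ hi
  rw [h, H.label_corner] at this
  omega

theorem succ_ne_zero {i : ℕ} (hi : i < k) : e (i + 1) ≠ e 0 := by
  intro h
  have h₁ := H.label_end (i + 1) hi
  have h₂ := H.label_end 0 (Nat.zero_le _)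
  rw [h] at h₁
  omega

theorem corner_ne_path {i : ℕ} (hi : i ≤ k) : b ≠ e i := by
  cases i with
  | zero => exact H.corner_ne
  | succ i => exact (H.succ_ne_corner hi).symm

theorem light_eq_zero_iff {y : E} : l y = e 0 ↔ y = e 0 := by
  conv_lhs => rw [← H.loop]
  exact l.apply_eq_iff_eq

theorem light_ne_corner {y : E} (hy : ∀ i ≤ k, y ≠ e i) (hd : d y ∉ sector l d e n k) :
    l y ≠ b := by
  rw [← H.step_last]
  exact IsFirstDescent.light_ne hy hd le_rfl le_rfl

/-- The loop `e 0` is the first edge of its own sector, which is nonempty because the edge closing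
it, `b` or `e 1`, differs from `e 0`. Its label `k` is therefore raised. -/
theorem raise_zero : raise f (sector l d e n k) (e 0) = k + 1 := by
  have h₁ := H.label_end 0 (Nat.zero_le _)
  have hn : n 0 ≠ 0 := by
    intro hn
    rcases Nat.eq_zero_or_pos k with rfl | hk
    · have := H.step_last
      rw [hn, pow_zero, Equiv.Perm.one_apply, H.loop] at this
      exact H.corner_ne this.symm
    · have := H.step 0 hk
      rw [hn, pow_zero, Equiv.Perm.one_apply, H.loop] at this
      exact H.succ_ne_zero hk this.symm
  have := H.raise_sector (Nat.zero_le k) (Nat.pos_of_ne_zero hn)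
  rwa [pow_zero, Equiv.Perm.one_apply, H.loop] at this

end

variable [DecidableEq E] {σ : Equiv.Perm E} (H : IsSuppressPath l d f e n k b)
  (hσ : IsShift σ e k)
include H hσ

theorem sew_last : (σ⁻¹ * Equiv.swap (e 0) b * l * σ) (e k) = b := by
  simp only [Equiv.Perm.mul_apply]
  rw [hσ.apply_last, H.loop, Equiv.swap_apply_left]
  exact hσ.inv_of_ne fun i hi => H.corner_ne_path hi

theorem sew_other {y : E} (hy : ∀ i ≤ k, y ≠ e i) (hd : d y ∉ sector l d e n k) :
    (σ⁻¹ * Equiv.swap (e 0) b * l * σ) y = l y := by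
  have h0 : l y ≠ e 0 := fun h => hy 0 (Nat.zero_le _) (H.light_eq_zero_iff.1 h)
  rw [IsFirstDescent.sew_apply hσ hy h0 (H.light_ne_corner hy hd)]
  refine hσ.inv_of_ne fun i hi => ?_
  cases i with
  | zero => exact h0
  | succ i => exact H.light_ne_succ hy hd hi

theorem sew_advance (i : ℕ) (hi : i ≤ k) (j : ℕ) (hj : j < n i) :
    (σ⁻¹ * Equiv.swap (e 0) b * l * σ) (d⁻¹ (((l * d⁻¹) ^ j) (l (e i))))
      = if j + 1 < n i then ((l * d⁻¹) ^ (j + 1)) (l (e i)) else e i := by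
  set y := d⁻¹ (((l * d⁻¹) ^ j) (l (e i))) with hy
  have hly : l y = ((l * d⁻¹) ^ (j + 1)) (l (e i)) := by
    rw [pow_succ', Equiv.Perm.mul_apply, Equiv.Perm.mul_apply]
  have hdy : d y ∈ sector l d e n k := ⟨i, hi, j, hj, by rw [hy, Equiv.Perm.apply_inv_apply]⟩
  have hye : ∀ i ≤ k, y ≠ e i := fun i' hi' h => H.dark_notMem hi' (h ▸ hdy)
  have h0 : l y ≠ e 0 := fun h => hye 0 (Nat.zero_le _) (H.light_eq_zero_iff.1 h)
  split_ifs with hj'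
  · have hW : l y ∈ sector l d e n k := ⟨i, hi, j + 1, hj', hly.symm⟩
    rw [IsFirstDescent.sew_apply hσ hye h0 (fun h => H.corner_notMem (Eq.subst h hW)), ← hly]
    refine hσ.inv_of_ne fun i' hi' => ?_
    cases i' with
    | zero => exact h0
    | succ i' => exact fun h => H.succ_notMem hi' (h ▸ hW)
  · obtain hj'' : j + 1 = n i := by omega
    rw [hj''] at hly
    rcases hi.lt_or_eq with hi' | rfl
    · rw [H.step i hi'] at hly
      rw [IsFirstDescent.sew_apply hσ hye h0 (hly ▸ H.succ_ne_corner hi'), hly, hσ.inv_succ hi']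
    -- The last sector closes on `e k`: the transposition sends `b` to `e 0`, and `σ⁻¹` sends `e 0`
    -- to `e k`.
    · rw [H.step_last] at hly
      simp only [Equiv.Perm.mul_apply]
      rw [hσ.apply_of_ne y hye, hly, Equiv.swap_apply_right, hσ.inv_zero]

theorem sew_start (i : ℕ) (hi : i < k) : (σ⁻¹ * Equiv.swap (e 0) b * l * σ) (e i)
    = if 0 < n (i + 1) then l (e (i + 1)) else e (i + 1) := by
  have h0 : l (e (i + 1)) ≠ e 0 := fun h => H.succ_ne_zero hi (H.light_eq_zero_iff.1 h)
  split_ifs with hn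
  · have hW : l (e (i + 1)) ∈ sector l d e n k := ⟨i + 1, hi, 0, hn, rfl⟩
    rw [IsFirstDescent.sew_apply_lt hσ hi h0 (fun h => H.corner_notMem (Eq.subst h hW))]
    refine hσ.inv_of_ne fun i' hi' => ?_
    cases i' with
    | zero => exact h0
    | succ i' => exact fun h => H.succ_notMem hi' (h ▸ hW)
  · obtain hn : n (i + 1) = 0 := by omega
    rcases (Nat.succ_le_of_lt hi).lt_or_eq with hi' | rfl
    · have := H.step (i + 1) hi'
      rw [hn, pow_zero, Equiv.Perm.one_apply] at this
      rw [IsFirstDescent.sew_apply_lt hσ hi h0 (this ▸ H.succ_ne_corner hi'), this,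
        hσ.inv_succ hi']
    · have := H.step_last
      rw [hn, pow_zero, Equiv.Perm.one_apply] at this
      simp only [Equiv.Perm.mul_apply]
      rw [hσ.apply_lt i hi, this, Equiv.swap_apply_right, hσ.inv_zero]

theorem isSewn :
    IsSewn (σ⁻¹ * Equiv.swap (e 0) b * l * σ) d (raise f (sector l d e n k)) e n k := by
  refine H.toIsFirstDescent.isSewn H.raise_zero (H.sew_advance hσ) (H.sew_start hσ)
    (fun h => ?_) (fun y hy hd => ?_)
  · rw [H.sew_last hσ, raise_of_notMem h, raise_of_notMem H.corner_notMem, H.label_corner,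
      ← H.label_eq]
    have := H.label_end k le_rfl
    omega
  · rw [H.sew_other hσ hy hd, raise_of_notMem (IsFirstDescent.light_notMem hy hd), H.label_eq]

end IsSuppressPath

/-- The path used for adding a face of degree one; it starts with the edge `e 0`, and the
last sector is the whole last vertex. -/
structure IsAddPath (l d : Equiv.Perm E) (f : E → ℕ) (e : ℕ → E) (n : ℕ → ℕ) (k : ℕ) :
    Prop extends IsFirstDescent l d f e n k where
  label_zero : f (e 0) = k + 1
  pos_last : 0 < n k
  step_last : ((l * d⁻¹) ^ n k) (l (e k)) = l (e k)
  first_last : ∀ j < n k, 0 < j → ((l * d⁻¹) ^ j) (l (e k)) ≠ l (e k)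

namespace IsAddPath

variable {l d : Equiv.Perm E} {f : E → ℕ} {e : ℕ → E} {n : ℕ → ℕ} {k : ℕ}

section

variable (H : IsAddPath l d f e n k)
include H

theorem label_path {i : ℕ} (hi : i ≤ k) : f (e i) + i = k + 1 := by
  cases i with
  | zero => exact H.label_zero
  | succ i =>
    have := H.label_succ hi
    omega

theorem zero_notMem : e 0 ∉ sector l d e n k := by
  rintro ⟨i, hi, j, hj, h⟩
  have h₁ := H.label_sector (j := j) hi
  rw [h, H.label_zero] at h₁
  omega

theorem path_notMem {i : ℕ} (hi : i ≤ k) : e i ∉ sector l d e n k := by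
  cases i with
  | zero => exact H.zero_notMem
  | succ i => exact H.succ_notMem hi

theorem path_inj {i j : ℕ} (hi : i ≤ k) (hj : j ≤ k) (h : e i = e j) : i = j := by
  have h₁ := H.label_path hi
  have h₂ := H.label_path hj
  rw [h] at h₁
  omega

theorem dark_last : ((l * d⁻¹) ^ (n k - 1)) (l (e k)) = d (e k) := by
  apply (l * d⁻¹).injective
  rw [← Equiv.Perm.mul_apply, ← pow_succ', Nat.sub_add_cancel H.pos_last, H.step_last,
    Equiv.Perm.mul_apply, Equiv.Perm.inv_apply_apply]

end

variable [DecidableEq E] {σ : Equiv.Perm E} (H : IsAddPath l d f e n k)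
  (hσ : IsShift σ e k)
include H hσ

omit H in
-- The edge `e k` becomes a light contour by itself, that of the new face of degree one.
theorem sew_last : (σ⁻¹ * Equiv.swap (e 0) (l (e 0)) * l * σ) (e k) = e k := by
  simp only [Equiv.Perm.mul_apply]
  rw [hσ.apply_last, Equiv.swap_apply_right, hσ.inv_zero]

theorem sew_advance (i : ℕ) (hi : i ≤ k) (j : ℕ) (hj : j < n i) :
    (σ⁻¹ * Equiv.swap (e 0) (l (e 0)) * l * σ) (d⁻¹ (((l * d⁻¹) ^ j) (l (e i))))
      = if j + 1 < n i then ((l * d⁻¹) ^ (j + 1)) (l (e i)) else e i := by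
  set y := d⁻¹ (((l * d⁻¹) ^ j) (l (e i))) with hy
  have hly : l y = ((l * d⁻¹) ^ (j + 1)) (l (e i)) := by
    rw [pow_succ', Equiv.Perm.mul_apply, Equiv.Perm.mul_apply]
  have hdy : d y ∈ sector l d e n k := ⟨i, hi, j, hj, by rw [hy, Equiv.Perm.apply_inv_apply]⟩
  have hlabel : f (l y) ≤ k := by
    have := H.label_sector (j := j + 1) hi
    rw [← hly] at this
    omega
  have h0 : l y ≠ e 0 := by
    intro h
    rw [h, H.label_zero] at hlabel
    omega
  -- Here the last sector is a complete vertex, so it contains `d (e k)`; the turn that completes it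
  -- is made from `e k`, which is now fixed by the light contour.
  by_cases hlast : y = e k
  · have hik : i = k := by
      have h₁ := H.label_sector (j := j + 1) hi
      have h₂ := H.label_end k le_rfl
      rw [← hly, hlast] at h₁
      omega
    subst hik
    have hj' : ¬ j + 1 < n i := by
      intro hj'
      refine H.first_last (j + 1) hj' (by omega) ?_
      rw [← hly, hlast]
    rw [if_neg hj', hlast, sew_last hσ]
  have hye : ∀ i ≤ k, y ≠ e i := by
    intro i' hi' h
    rcases hi'.lt_or_eq with hi'' | rfl
    · exact H.dark_notMem hi'' (h ▸ hdy)
    · exact hlast h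
  have hb : l y ≠ l (e 0) := fun h => hye 0 (Nat.zero_le _) (l.injective h)
  rw [IsFirstDescent.sew_apply hσ hye h0 hb]
  split_ifs with hj'
  · have hW : l y ∈ sector l d e n k := ⟨i, hi, j + 1, hj', hly.symm⟩
    rw [← hly]
    exact hσ.inv_of_ne fun i' hi' h => H.path_notMem hi' (h ▸ hW)
  · obtain hj'' : j + 1 = n i := by omega
    rw [hj''] at hly
    rcases hi.lt_or_eq with hi' | rfl
    · rw [H.step i hi'] at hly
      rw [hly, hσ.inv_succ hi']
    · rw [H.step_last] at hly
      exact absurd (l.injective hly) hlast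

theorem sew_start (i : ℕ) (hi : i < k) : (σ⁻¹ * Equiv.swap (e 0) (l (e 0)) * l * σ) (e i)
    = if 0 < n (i + 1) then l (e (i + 1)) else e (i + 1) := by
  have h0 : l (e (i + 1)) ≠ e 0 := by
    intro h
    have := H.label_end (i + 1) hi
    rw [h, H.label_zero] at this
    omega
  have hb : l (e (i + 1)) ≠ l (e 0) := by
    intro h
    have := H.path_inj hi (Nat.zero_le _) (l.injective h)
    omega
  rw [IsFirstDescent.sew_apply_lt hσ hi h0 hb]
  split_ifs with hn
  · have hW : l (e (i + 1)) ∈ sector l d e n k := ⟨i + 1, hi, 0, hn, rfl⟩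
    exact hσ.inv_of_ne fun i' hi' h => H.path_notMem hi' (h ▸ hW)
  · obtain hn : n (i + 1) = 0 := by omega
    rcases (Nat.succ_le_of_lt hi).lt_or_eq with hi' | rfl
    · have := H.step (i + 1) hi'
      rw [hn, pow_zero, Equiv.Perm.one_apply] at this
      rw [this, hσ.inv_succ hi']
    · exact absurd H.pos_last (Nat.not_lt.2 hn.le)

omit [DecidableEq E] in
theorem shift_inv_light_zero :
    σ⁻¹ (l (e 0)) = if 0 < n 0 then l (e 0) else e 0 := by
  split_ifs with hn
  · have hW : l (e 0) ∈ sector l d e n k := ⟨0, Nat.zero_le _, 0, hn, rfl⟩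
    exact hσ.inv_of_ne fun i' hi' h => H.path_notMem hi' (h ▸ hW)
  · rcases Nat.eq_zero_or_pos k with rfl | hk
    · exact absurd H.pos_last hn
    · have := H.step 0 hk
      rw [Nat.eq_zero_of_not_pos hn, pow_zero, Equiv.Perm.one_apply] at this
      rw [this, hσ.inv_succ hk]

theorem isSewn : IsSewn (σ⁻¹ * Equiv.swap (e 0) (l (e 0)) * l * σ) d
    (raise f (sector l d e n k)) e n k := by
  have h0 : raise f (sector l d e n k) (e 0) = k + 1 := by
    rw [raise_of_notMem H.zero_notMem, H.label_zero]
  refine H.toIsFirstDescent.isSewn h0 (H.sew_advance hσ) (H.sew_start hσ)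
    (fun h => ?_) (fun y hy hd => ?_)
  -- The last sector contains `d (e k)`, so this case is void.
  · exact absurd ⟨k, le_rfl, n k - 1, Nat.sub_lt H.pos_last one_pos, H.dark_last⟩ h
  · have hb : l y ≠ l (e 0) := fun h => hy 0 (Nat.zero_le _) (l.injective h)
    rw [← H.label_eq]
    -- The edge that preceded `e 0` in its contour now leads to the first edge of the sector number
    -- `0`, or to `e 0` if this sector is empty. Both have raised label `k + 1`, the old label of `e
    -- 0`.
    by_cases hy0 : l y = e 0
    · simp only [Equiv.Perm.mul_apply]
      rw [hσ.apply_of_ne y hy, hy0, Equiv.swap_apply_left, H.shift_inv_light_zero hσ, H.label_zero]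
      split_ifs with hn
      · exact H.raise_sector (Nat.zero_le k) hn
      · exact h0
    · rw [IsFirstDescent.sew_apply hσ hy hy0 hb, hσ.inv_of_ne,
        raise_of_notMem (IsFirstDescent.light_notMem hy hd)]
      intro i hi
      cases i with
      | zero => exact hy0
      | succ i => exact H.light_ne_succ hy hd hi

/-- Both ends of the first sector are at the same vertex after the sewing. -/
theorem sew_sameCycle_zero : ((σ⁻¹ * Equiv.swap (e 0) (l (e 0)) * l * σ) * d⁻¹).SameCycle
    (σ⁻¹ (l (e 0))) (e 0) := by
  set l' := σ⁻¹ * Equiv.swap (e 0) (l (e 0)) * l * σ with hl'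
  rw [H.shift_inv_light_zero hσ]
  split_ifs with hn
  · have key : ∀ j ≤ n 0, ((l' * d⁻¹) ^ j) (l (e 0))
        = if j < n 0 then ((l * d⁻¹) ^ j) (l (e 0)) else e 0 := by
      intro j
      induction j with
      | zero => simp [hn]
      | succ j ih =>
        intro hj
        rw [pow_succ', Equiv.Perm.mul_apply, ih (by omega), if_pos (by omega),
          Equiv.Perm.mul_apply, H.sew_advance hσ 0 (Nat.zero_le _) j (by omega)]
    refine ⟨n 0, ?_⟩
    rw [zpow_natCast, key _ le_rfl, if_neg (lt_irrefl _)]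
  · exact Equiv.Perm.SameCycle.refl _ _

end IsAddPath

end Sewing

/-! ### Distances and lightest geodesics in a sewn map. -/

namespace PreHypermap

variable {E ι : Type*} {m : PreHypermap E ι} {O : EdgeOrientation} {h : E → ℕ} {e : ℕ → E}
  {n : ℕ → ℕ} {k : ℕ}

section

variable (H : IsSewn (m.lightNext O) (m.darkNext O) h e n k)
include H

theorem isSewn_head_eq {i : ℕ} (hi : i < k) : m.head O (e i) = m.tail O (e (i + 1)) := by
  rw [← H.back i hi, head_eq_tail_darkNext]
  exact (m.tail_rot_pow O _ _).symm

theorem isSewn_isPath (i : ℕ) (hi : i ≤ k) :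
    m.IsPath O (m.tail O (e 0)) ((List.range i).map e) (m.tail O (e i)) := by
  induction i with
  | zero => rfl
  | succ i ih =>
    rw [List.range_succ, List.map_append]
    exact (ih (by omega)).append ⟨rfl, isSewn_head_eq H hi⟩

variable [Finite E] (hm : m.Connected)
include hm

/-- The path itself gives the upper bound, and the difference of labels the lower one. -/
theorem Connected.isSewn_dist {i : ℕ} (hi : i ≤ k) :
    m.dist O (m.tail O (e 0)) (m.tail O (e i)) = i := by
  apply le_antisymm
  · simpa using dist_le_length (isSewn_isPath H i hi)
  · have h₁ := hm.le_dist_add H.label_eq H.label_le (e 0) (e i)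
    have h₂ := H.label_path 0 (Nat.zero_le _)
    have h₃ := H.label_path i hi
    omega

/-- Turning in the reverse orientation meets `e i` after `n (i + 1)` turns. The edges met before
have origins of label at most `k - i`, against `k + 1` at the origin of `e 0`; they are at distance
at least `i + 1` from it and do not go closer. -/
theorem Connected.isSewn_lightestEdge {i : ℕ} (hi : i < k) :
    m.lightestEdge O.rev (m.tail O (e 0)) (e (i + 1)) = e i := by
  have hturn : ∀ j ≤ n (i + 1), m.turn O.rev (e (i + 1)) j
      = (m.lightNext O)⁻¹ ((m.rot O ^ (n (i + 1) + 1 - j)) (m.darkNext O (e i))) := by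
    intro j hj
    have h₁ : m.turn O.rev (e (i + 1)) j = (m.lightNext O)⁻¹ ((m.rot O ^ j)⁻¹ (e (i + 1))) := by
      -- The rotation of the reverse orientation is the inverse of `rot`, conjugated by the light
      -- contour.
      have h₂ : (m.lightNext O.rev * (m.darkNext O.rev)⁻¹) ^ j
          = (m.lightNext O)⁻¹ * (m.rot O ^ j)⁻¹ * (m.lightNext O)⁻¹⁻¹ := by
        rw [← inv_pow, ← conj_pow, rot, lightNext_rev, darkNext_rev]
        group
      unfold turn
      rw [h₂, lightNext_rev, Equiv.Perm.mul_apply, Equiv.Perm.mul_apply, inv_inv,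
        Equiv.Perm.apply_inv_apply]
    rw [h₁, ← H.back i hi, ← Equiv.Perm.mul_apply ((m.rot O ^ j)⁻¹)]
    congr 2
    rw [inv_mul_eq_iff_eq_mul, ← pow_add]
    congr 1
    omega
  have hlast : m.turn O.rev (e (i + 1)) (n (i + 1)) = e i := by
    rw [hturn _ le_rfl, Nat.add_sub_cancel_left, pow_one, rot_darkNext,
      Equiv.Perm.inv_apply_apply]
  have hleast : IsLeast {j | m.dist O.rev (m.head O.rev (m.turn O.rev (e (i + 1)) j))
      (m.tail O (e 0)) + 1 = m.dist O.rev (m.head O.rev (e (i + 1))) (m.tail O (e 0))}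
      (n (i + 1)) := by
    have hi' := hm.isSewn_dist H (i := i + 1) hi
    constructor
    · rw [Set.mem_ofPred_eq, hlast, head_rev, head_rev, dist_rev, dist_rev, hi',
        hm.isSewn_dist H hi.le]
    · intro j hj
      by_contra! hlt
      rw [Set.mem_ofPred_eq, head_rev, head_rev, dist_rev, dist_rev, hi', hturn j hlt.le] at hj
      obtain ⟨j', hj'⟩ : ∃ j', n (i + 1) - j = j' + 1 := ⟨n (i + 1) - j - 1, by omega⟩
      rw [show n (i + 1) + 1 - j = (j' + 1) + 1 by omega, pow_succ', Equiv.Perm.mul_apply, rot,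
        Equiv.Perm.mul_apply, Equiv.Perm.inv_apply_apply] at hj
      have h₁ := hm.le_dist_add H.label_eq H.label_le (e 0) ((m.darkNext O)⁻¹
        (((m.lightNext O * (m.darkNext O)⁻¹) ^ (j' + 1)) (m.darkNext O (e i))))
      have h₂ := H.label_path 0 (Nat.zero_le _)
      have h₃ := H.back_first i hi j' (by omega)
      omega
  unfold lightestEdge
  rw [hleast.csInf_eq, hlast]

theorem Connected.isSewn_lightestSteps (i : ℕ) (hi : i ≤ k) :
    m.lightestSteps O.rev (m.tail O (e 0)) i (e i) = ((List.range i).map e).reverse := by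
  induction i with
  | zero => rfl
  | succ i ih =>
    rw [lightestSteps, hm.isSewn_lightestEdge H hi, ih (by omega), List.range_succ]
    simp

end

end PreHypermap

/-! ### Counting cycles -/

section Cycles

variable {E : Type*}

/-- The set of the elements of the cycle of `x`. -/
def Equiv.Perm.cycleSet (g : Equiv.Perm E) (x : E) : Set E := {y | g.SameCycle x y}

theorem Equiv.Perm.cycleSet_eq_iff {g : Equiv.Perm E} {x y : E} :
    g.cycleSet x = g.cycleSet y ↔ g.SameCycle x y := by
  constructor
  · intro h
    have : y ∈ g.cycleSet y := Equiv.Perm.SameCycle.refl _ _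
    rw [← h] at this
    exact this
  · intro h
    ext z
    exact ⟨fun hz => h.symm.trans hz, fun hz => h.trans hz⟩

theorem Equiv.Perm.cycleSet_congr [Finite E] {g g' : Equiv.Perm E} {x : E}
    (h : ∀ u, g.SameCycle x u → g' u = g u) : g'.cycleSet x = g.cycleSet x := by
  have hpow : ∀ n : ℕ, (g' ^ n) x = (g ^ n) x := by
    intro n
    induction n with
    | zero => rfl
    | succ n ih =>
      rw [pow_succ', pow_succ', Equiv.Perm.mul_apply, Equiv.Perm.mul_apply, ih]
      exact h _ ⟨n, by simp⟩
  ext u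
  constructor
  · intro hu
    obtain ⟨n, rfl⟩ := Equiv.Perm.SameCycle.exists_nat_pow_eq hu
    exact ⟨n, by rw [zpow_natCast, hpow]⟩
  · intro hu
    obtain ⟨n, rfl⟩ := Equiv.Perm.SameCycle.exists_nat_pow_eq hu
    exact ⟨n, by rw [zpow_natCast, hpow]⟩

theorem ncard_range_eq_of_ker {α β γ : Type*} {F : α → β} {G : α → γ}
    (h : ∀ x y, F x = F y ↔ G x = G y) : (Set.range F).ncard = (Set.range G).ncard := by
  have hker : Setoid.ker F = Setoid.ker G := Setoid.ext fun x y => by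
    simpa [Setoid.ker_def] using h x y
  rw [← Nat.card_coe_set_eq, ← Nat.card_coe_set_eq,
    ← Nat.card_congr (Setoid.quotientKerEquivRange F),
    ← Nat.card_congr (Setoid.quotientKerEquivRange G), hker]

theorem PreHypermap.ncard_range_vertexOf {ι : Type*} (m : PreHypermap E ι)
    (O : EdgeOrientation) :
    (Set.range m.vertexOf).ncard = (Set.range (m.rot O).cycleSet).ncard := by
  have hr : Set.range m.vertexOf = Set.range (m.tail O) := by
    cases O
    · rfl
    · exact (m.light.surjective.range_comp m.vertexOf).symm
  rw [hr]
  exact ncard_range_eq_of_ker fun x y => by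
    rw [m.tail_eq_tail_iff O, Equiv.Perm.cycleSet_eq_iff]

namespace IsSuppressPath

variable {l d : Equiv.Perm E} {f : E → ℕ} {e : ℕ → E} {n : ℕ → ℕ} {k : ℕ} {b : E}
  [DecidableEq E] {σ : Equiv.Perm E} (H : IsSuppressPath l d f e n k b)
  (hσ : IsShift σ e k)
include H hσ

theorem sameCycle_of_sector {i : ℕ} (hi : i ≤ k) {j : ℕ} (hj : j < n i) :
    ((σ⁻¹ * Equiv.swap (e 0) b * l * σ) * d⁻¹).SameCycle
      (((l * d⁻¹) ^ j) (l (e i))) (e i) := by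
  obtain ⟨r, hr⟩ : ∃ r, n i = j + 1 + r := ⟨n i - (j + 1), by omega⟩
  rw [← Equiv.Perm.sameCycle_apply_left, Equiv.Perm.mul_apply, H.sew_advance hσ i hi j hj]
  induction r generalizing j with
  | zero => rw [if_neg (by omega)]
  | succ r ih =>
    rw [if_pos (by omega), ← Equiv.Perm.sameCycle_apply_left, Equiv.Perm.mul_apply,
      H.sew_advance hσ i hi _ (by omega)]
    exact ih (by omega) (by omega)

theorem sew_turn_other {x : E} (hx : ∀ i ≤ k, x ≠ d (e i)) (hW : x ∉ sector l d e n k) :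
    ((σ⁻¹ * Equiv.swap (e 0) b * l * σ) * d⁻¹) x = (l * d⁻¹) x := by
  rw [Equiv.Perm.mul_apply, Equiv.Perm.mul_apply]
  refine H.sew_other hσ (fun i hi h => hx i hi ?_) ?_
  · rw [← h, Equiv.Perm.apply_inv_apply]
  · rwa [Equiv.Perm.apply_inv_apply]

/-- Outside the sectors and the edges `d (e i)`, the new rotation agrees with the old one; it can be
followed up to the first edge `d (e j)` encountered. -/
theorem sameCycle_dark_of_notMem (r : ℕ) {x : E} (hW : x ∉ sector l d e n k) {i : ℕ}
    (hi : i ≤ k) (hr : ((l * d⁻¹) ^ r) x = d (e i)) :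
    ∃ j ≤ k, ((σ⁻¹ * Equiv.swap (e 0) b * l * σ) * d⁻¹).SameCycle x (d (e j)) := by
  induction r generalizing x with
  | zero => exact ⟨i, hi, hr.sameCycle _⟩
  | succ r ih =>
    by_cases hx : ∀ i ≤ k, x ≠ d (e i)
    · have hW' : (l * d⁻¹) x ∉ sector l d e n k := by
        rw [Equiv.Perm.mul_apply]
        refine IsFirstDescent.light_notMem (fun i hi h => hx i hi ?_) ?_
        · rw [← h, Equiv.Perm.apply_inv_apply]
        · rwa [Equiv.Perm.apply_inv_apply]
      rw [pow_succ, Equiv.Perm.mul_apply] at hr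
      obtain ⟨j, hj, h⟩ := ih hW' hr
      refine ⟨j, hj, ?_⟩
      rwa [← H.sew_turn_other hσ hx hW, Equiv.Perm.sameCycle_apply_left] at h
    · push Not at hx
      obtain ⟨j, hj, h⟩ := hx
      exact ⟨j, hj, h.sameCycle _⟩

/-- Sewing after a slit that joins two faces creates one more vertex. -/
theorem ncard_range_cycleSet [Finite E] :
    (Set.range ((σ⁻¹ * Equiv.swap (e 0) b * l * σ) * d⁻¹).cycleSet).ncard
      = (Set.range (l * d⁻¹).cycleSet).ncard + 1 := by
  set g := l * d⁻¹ with hg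
  set g' := (σ⁻¹ * Equiv.swap (e 0) b * l * σ) * d⁻¹ with hg'
  have S := H.isSewn hσ
  set h := raise f (sector l d e n k)
  have hlabel' : ∀ x, h (g' x) = h x := fun x => by
    rw [hg', Equiv.Perm.mul_apply, S.label_eq, Equiv.Perm.apply_inv_apply]
  have hdark : ∀ i, g (d (e i)) = l (e i) := fun i => by
    rw [hg, Equiv.Perm.mul_apply, Equiv.Perm.inv_apply_apply]
  have hlast : h (d (e k)) = 0 := by
    have h₁ := H.label_end k le_rfl
    rw [H.label_eq] at h₁
    have h₂ : h (d (e k)) = f (d (e k)) := raise_of_notMem (H.dark_notMem le_rfl)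
    omega
  -- The vertices affected are, before the sewing, the ends of the `k + 1` path edges, and after it,
  -- their `k + 1` origins together with the end of `e k`, which has label `0`. Labels show that
  -- they are pairwise distinct, and all other vertices are common to both maps.
  set A : Set (Set E) := (fun i => g.cycleSet (l (e i))) '' (Finset.range (k + 1) : Set ℕ) with hA
  set B : Set (Set E) := (fun i => g'.cycleSet (e i)) '' (Finset.range (k + 1) : Set ℕ) with hB
  have hAcard : A.ncard = k + 1 := by
    rw [hA, Set.InjOn.ncard_image, Set.ncard_coe_finset, Finset.card_range]
    intro i hi j hj hij
    simp only [Finset.coe_range, Set.mem_Iio] at hi hj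
    have h₁ := (Equiv.Perm.cycleSet_eq_iff.1 hij).map_eq H.label_turn
    have h₂ := H.label_end i (by omega)
    have h₃ := H.label_end j (by omega)
    omega
  have hBcard : B.ncard = k + 1 := by
    rw [hB, Set.InjOn.ncard_image, Set.ncard_coe_finset, Finset.card_range]
    intro i hi j hj hij
    simp only [Finset.coe_range, Set.mem_Iio] at hi hj
    have h₁ := (Equiv.Perm.cycleSet_eq_iff.1 hij).map_eq hlabel'
    have h₂ := S.label_path i (by omega)
    have h₃ := S.label_path j (by omega)
    omega
  have hBlast : g'.cycleSet (d (e k)) ∉ B := by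
    rintro ⟨i, hi, hij⟩
    simp only [Finset.coe_range, Set.mem_Iio] at hi
    have h₁ := (Equiv.Perm.cycleSet_eq_iff.1 hij).map_eq hlabel'
    have h₂ := S.label_path i (by omega)
    omega
  have hAsub : A ⊆ Set.range g.cycleSet := by
    rintro _ ⟨i, _, rfl⟩
    exact ⟨_, rfl⟩
  have hBsub : insert (g'.cycleSet (d (e k))) B ⊆ Set.range g'.cycleSet := by
    rintro _ (rfl | ⟨i, _, rfl⟩) <;> exact ⟨_, rfl⟩
  have hmemA : ∀ {x i}, i ≤ k → g.SameCycle x (l (e i)) → g.cycleSet x ∈ A := fun hi hx =>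
    ⟨_, by simpa using Nat.lt_succ_of_le hi, (Equiv.Perm.cycleSet_eq_iff.2 hx).symm⟩
  have hmemB : ∀ {x i}, i ≤ k → g'.SameCycle x (e i) → g'.cycleSet x ∈ B := fun hi hx =>
    ⟨_, by simpa using Nat.lt_succ_of_le hi, (Equiv.Perm.cycleSet_eq_iff.2 hx).symm⟩
  -- The rotation is modified only on the sectors and at the edges `d (e i)`, all of which start
  -- from vertices of `A`.
  have hkeep : ∀ x, g.cycleSet x ∉ A → g'.cycleSet x = g.cycleSet x := by
    intro x hx
    refine Equiv.Perm.cycleSet_congr fun u hu => H.sew_turn_other hσ (fun i hi h => hx ?_) ?_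
    · exact hmemA hi (by rwa [← hdark, Equiv.Perm.sameCycle_apply_right, ← h])
    · rintro ⟨i, hi, j, _, rfl⟩
      exact hx (hmemA hi (Equiv.Perm.sameCycle_pow_right.1 hu))
  have hdiff : Set.range g.cycleSet \ A
      = Set.range g'.cycleSet \ insert (g'.cycleSet (d (e k))) B := by
    ext C
    constructor
    · rintro ⟨⟨x, rfl⟩, hx⟩
      have hk := hkeep x hx
      refine ⟨⟨x, hk⟩, ?_⟩
      have hcyc : ∀ {u}, g.cycleSet x = g'.cycleSet u → g.SameCycle x u := by
        intro u hu
        rw [← hk, Equiv.Perm.cycleSet_eq_iff] at hu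
        have : u ∈ g'.cycleSet x := hu
        rwa [hk] at this
      rintro (hx' | ⟨i, hi, hx'⟩)
      · exact hx (hmemA le_rfl (by
          rw [← hdark, Equiv.Perm.sameCycle_apply_right]
          exact hcyc hx'))
      · simp only [Finset.coe_range, Set.mem_Iio] at hi
        have hxi := hcyc hx'.symm
        cases i with
        | zero => exact hx (hmemA (Nat.zero_le _) (by rwa [H.loop]))
        | succ i =>
          rw [← H.step i (by omega), ← hg, Equiv.Perm.sameCycle_pow_right] at hxi
          exact hx (hmemA (by omega) hxi)
    · rintro ⟨⟨x, rfl⟩, hx⟩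
      have hx' : g.cycleSet x ∉ A := by
        rintro ⟨i, hi, hix⟩
        simp only [Finset.coe_range, Set.mem_Iio] at hi
        have hcyc := Equiv.Perm.cycleSet_eq_iff.1 hix
        by_cases hW : x ∈ sector l d e n k
        · obtain ⟨i', hi', j, hj, rfl⟩ := hW
          exact hx (Or.inr (hmemB hi' (H.sameCycle_of_sector hσ hi' hj)))
        -- Outside the sectors, the rest of an affected vertex leads to some `d (e j)`, hence to the
        -- new vertex of `e (j + 1)`, or to the end of `e k` when `j = k`.
        · rw [← hdark, Equiv.Perm.sameCycle_apply_left] at hcyc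
          obtain ⟨r, hr⟩ := hcyc.symm.exists_nat_pow_eq
          obtain ⟨j, hj, hxj⟩ := H.sameCycle_dark_of_notMem hσ r hW (by omega : i ≤ k) hr
          rcases hj.lt_or_eq with hj' | rfl
          · refine hx (Or.inr (hmemB (i := j + 1) hj' ?_))
            rw [← S.back j hj', ← hg', Equiv.Perm.sameCycle_pow_right]
            exact hxj
          · exact hx (Or.inl (Equiv.Perm.cycleSet_eq_iff.2 hxj))
      exact ⟨⟨x, (hkeep x hx').symm⟩, by rwa [hkeep x hx']⟩
  have h₁ := Set.ncard_sdiff_add_ncard_of_subset hAsub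
  have h₂ := Set.ncard_sdiff_add_ncard_of_subset hBsub
  rw [Set.ncard_insert_of_notMem hBlast] at h₂
  rw [hdiff] at h₁
  omega

end IsSuppressPath

end Cycles

/-! ### Connectivity of a sewn map. -/

section Connectivity

variable {E ι κ : Type*} [DecidableEq E] {m : PreHypermap E ι} {m' : PreHypermap E κ}
  {O : EdgeOrientation} {h : E → ℕ} {e : ℕ → E} {n : ℕ → ℕ} {k : ℕ} {b : E} {σ : Equiv.Perm E}

/-- A relation stable under the new contours relates all the path edges to each other, so it does
not see `σ`. Once it relates `e 0` to `b`, it does not see the transposition either, hence it is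
stable under the old contours and total. The link between `e 0` and `b` is a hypothesis because each
operation provides it in its own way. -/
theorem PreHypermap.Connected.of_isSewn (hm : m.Connected)
    (hd : m'.darkNext O = m.darkNext O)
    (hl : m'.lightNext O = σ⁻¹ * Equiv.swap (e 0) b * m.lightNext O * σ) (hσ : IsShift σ e k)
    (H : IsSewn (m'.lightNext O) (m'.darkNext O) h e n k)
    (hb : ∀ r : Setoid E, (∀ y, r y (m'.lightNext O y)) →
      (∀ y y', (m'.rot O).SameCycle y y' → r y y') →
      (∀ i ≤ k, r (e 0) (e i)) → (∀ y, r (σ⁻¹ y) y) → r (e 0) b) : m'.Connected := by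
  rw [m'.connected_iff O]
  intro r h₁ h₂
  have hrot : ∀ y y', (m'.rot O).SameCycle y y' → r y y' := by
    intro y y' hy
    have hF : ∀ x, (Quotient.mk r (m'.rot O x)) = Quotient.mk r x := fun x =>
      Quotient.sound (by
        have h₃ := h₁ ((m'.darkNext O)⁻¹ x)
        have h₄ := h₂ ((m'.darkNext O)⁻¹ x)
        rw [Equiv.Perm.apply_inv_apply] at h₄
        exact r.trans (r.symm h₃) h₄)
    exact Quotient.exact (hy.map_eq hF)
  have hpath : ∀ i ≤ k, r (e 0) (e i) := by
    intro i
    induction i with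
    | zero => exact fun _ => r.refl _
    | succ i ih =>
      intro hi
      refine r.trans (ih (by omega)) (r.trans (h₂ _) (hrot _ _ ?_))
      rw [← H.back i hi]
      exact Equiv.Perm.sameCycle_pow_right.2 (Equiv.Perm.SameCycle.refl _ _)
  have hshift : ∀ y, r (σ y) y := by
    intro y
    by_cases hy : ∀ i ≤ k, y ≠ e i
    · rw [hσ.apply_of_ne y hy]
    · push Not at hy
      obtain ⟨i, hi, rfl⟩ := hy
      rcases hi.lt_or_eq with hi' | rfl
      · rw [hσ.apply_lt i hi']
        exact r.trans (r.symm (hpath _ hi')) (hpath _ hi)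
      · rw [hσ.apply_last]
        exact hpath _ hi
  have hshift' : ∀ y, r (σ⁻¹ y) y := fun y => by
    have := hshift (σ⁻¹ y)
    rw [Equiv.Perm.apply_inv_apply] at this
    exact r.symm this
  have h0b := hb r h₁ hrot hpath hshift'
  have hswap : ∀ y, r (Equiv.swap (e 0) b y) y := by
    intro y
    rcases eq_or_ne y (e 0) with rfl | hy
    · rw [Equiv.swap_apply_left]
      exact r.symm h0b
    rcases eq_or_ne y b with rfl | hy'
    · rw [Equiv.swap_apply_right]
      exact h0b
    · rw [Equiv.swap_apply_of_ne_of_ne hy hy']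
  have hlight : ∀ y, m.lightNext O y
      = Equiv.swap (e 0) b (σ (m'.lightNext O (σ⁻¹ y))) := by
    intro y
    rw [hl]
    simp only [Equiv.Perm.mul_apply, Equiv.Perm.apply_inv_apply, Equiv.swap_apply_self]
  refine (m.connected_iff O).1 hm r (fun y => ?_) (fun y => by rw [← hd]; exact h₂ y)
  rw [hlight]
  exact r.trans (r.symm (hshift' y)) (r.trans (h₁ _)
    (r.trans (r.symm (hshift _)) (r.symm (hswap _))))

end Connectivity

/-! ### The cyclic shift along a path. -/

section ShiftOfList

variable {E : Type*} [DecidableEq E]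

theorem isShift_formPerm {e : ℕ → E} {k : ℕ} (he : ∀ i ≤ k, ∀ j ≤ k, e i = e j → i = j) :
    IsShift ((List.range (k + 1)).map e).formPerm e k := by
  have hnodup : ((List.range (k + 1)).map e).Nodup :=
    List.Nodup.map_on (fun i hi j hj => he i (by simpa [Nat.lt_succ_iff] using hi) j
      (by simpa [Nat.lt_succ_iff] using hj)) List.nodup_range
  have hget : ∀ i (hi : i < ((List.range (k + 1)).map e).length),
      ((List.range (k + 1)).map e).formPerm (e i) = e ((i + 1) % (k + 1)) := by
    intro i hi
    have := List.formPerm_apply_getElem _ hnodup i hi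
    simpa using this
  refine ⟨fun i hi => ?_, ?_, fun x hx => List.formPerm_apply_of_notMem ?_⟩
  · rw [hget i (by simp; omega), Nat.mod_eq_of_lt (by omega)]
  · rw [hget k (by simp), Nat.mod_self]
  · intro h
    simp only [List.mem_map, List.mem_range] at h
    obtain ⟨i, hi, rfl⟩ := h
    exact hx i (by omega) rfl

end ShiftOfList

/-! ### Contours of light faces after the insertion of a side -/

section InsertSide

variable {E : Type*} [DecidableEq E]

/-- The transposition inserts the fixed point `z` just before `c` in its cycle, so membership in
cycles can be tested after replacing `z` with `c`. -/
theorem sameCycle_swap_mul_iff {g : Equiv.Perm E} {z c : E} (hz : g z = z) {u w : E} :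
    (Equiv.swap z c * g).SameCycle u w
      ↔ g.SameCycle (if u = z then c else u) (if w = z then c else w) := by
  set g' := Equiv.swap z c * g with hg'
  have hzc : g' z = c := by rw [hg', Equiv.Perm.mul_apply, hz, Equiv.swap_apply_left]
  have hcases : ∀ x, x ≠ z → (g x = c ∧ g' x = z) ∨ (g x ≠ z ∧ g' x = g x) := by
    intro x hx
    have h₁ : g x ≠ z := fun h => hx (g.injective (h.trans hz.symm))
    rcases eq_or_ne (g x) c with h | h
    · exact Or.inl ⟨h, by rw [hg', Equiv.Perm.mul_apply, h, Equiv.swap_apply_right]⟩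
    · exact Or.inr ⟨h₁, by rw [hg', Equiv.Perm.mul_apply, Equiv.swap_apply_of_ne_of_ne h₁ h]⟩
  constructor
  · intro h
    rw [← Equiv.Perm.cycleSet_eq_iff]
    refine h.map_eq (F := fun x => g.cycleSet (if x = z then c else x)) fun x => ?_
    simp only [Equiv.Perm.cycleSet_eq_iff]
    rcases eq_or_ne x z with rfl | hx
    · rw [hzc, ite_self, if_pos rfl]
    · rw [if_neg hx]
      rcases hcases x hx with ⟨h₁, h₂⟩ | ⟨h₁, h₂⟩
      · rw [h₂, if_pos rfl, ← h₁, Equiv.Perm.sameCycle_apply_left]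
      · rw [h₂, if_neg h₁, Equiv.Perm.sameCycle_apply_left]
  · intro h
    have hmove : ∀ x, g'.SameCycle x (if x = z then c else x) := by
      intro x
      split_ifs with hx
      · rw [← hzc, hx, Equiv.Perm.sameCycle_apply_right]
      · exact Equiv.Perm.SameCycle.refl _ _
    refine (hmove u).trans (Equiv.Perm.SameCycle.trans ?_ (hmove w).symm)
    rw [← Equiv.Perm.cycleSet_eq_iff]
    refine h.map_eq (F := g'.cycleSet) fun x => ?_
    rw [Equiv.Perm.cycleSet_eq_iff]
    rcases eq_or_ne x z with rfl | hx
    · rw [hz]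
    · rcases hcases x hx with ⟨h₁, h₂⟩ | ⟨h₁, h₂⟩
      · rw [h₁, ← hzc, ← h₂, Equiv.Perm.sameCycle_apply_left, Equiv.Perm.sameCycle_apply_left]
      · rw [← h₂, Equiv.Perm.sameCycle_apply_left]

namespace PreHypermap

/-- The light contours of `my` are obtained from those of `mx` by the relabelling `σ⁻¹` and the
insertion, before `c`, of the edge `z` that bounded the face number `0`. -/
structure IsInsertion {s : ℕ} (mx : PreHypermap E (Fin (s + 2))) (my : PreHypermap E (Fin (s + 1)))
    (σ : Equiv.Perm E) (z c : E) : Prop where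
  light : my.light = Equiv.swap z c * (σ⁻¹ * mx.light * σ)
  apply_edge : σ z = mx.mark 0
  fix : mx.light (mx.mark 0) = mx.mark 0
  corner_ne : c ≠ z
  mark : ∀ i, my.light.SameCycle (my.mark i) (σ⁻¹ (mx.mark i.succ))
  mark_ne : ∀ i : Fin (s + 1), mx.mark i.succ ≠ mx.mark 0

namespace IsInsertion

variable {s : ℕ} {mx : PreHypermap E (Fin (s + 2))} {my : PreHypermap E (Fin (s + 1))}
    {σ : Equiv.Perm E} {z c : E} (H : IsInsertion mx my σ z c)
include H

theorem mem_lightFace_iff (i : Fin (s + 1)) (u : E) :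
    u ∈ my.lightFace (my.mark i)
      ↔ σ (if u = z then c else u) ∈ mx.lightFace (mx.mark i.succ) := by
  have hz : (σ⁻¹ * mx.light * σ) z = z := by
    rw [Equiv.Perm.mul_apply, Equiv.Perm.mul_apply, H.apply_edge, H.fix, ← H.apply_edge,
      Equiv.Perm.inv_apply_apply]
  have h₁ : u ∈ my.lightFace (my.mark i) ↔ my.light.SameCycle (σ⁻¹ (mx.mark i.succ)) u :=
    ⟨fun h => (H.mark i).symm.trans h, fun h => (H.mark i).trans h⟩
  have h₂ : σ⁻¹ (mx.mark i.succ) ≠ z := fun h => H.mark_ne i (by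
    rw [← H.apply_edge, ← h, Equiv.Perm.apply_inv_apply])
  have h₃ : σ⁻¹ * mx.light * σ = σ⁻¹ * mx.light * σ⁻¹⁻¹ := by rw [inv_inv]
  rw [h₁, H.light, sameCycle_swap_mul_iff hz, if_neg h₂, h₃, Equiv.Perm.sameCycle_conj, inv_inv,
    Equiv.Perm.apply_inv_apply]
  rfl

theorem mem_lightFace_zero_iff (u : E) : u ∈ mx.lightFace (mx.mark 0) ↔ u = mx.mark 0 :=
  ⟨fun h => (Equiv.Perm.SameCycle.eq_of_left h H.fix).symm,
    fun h => h ▸ Equiv.Perm.SameCycle.refl _ _⟩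

theorem zero_notMem_lightFace (i : Fin (s + 1)) : mx.mark 0 ∉ mx.lightFace (mx.mark i.succ) :=
  fun h => H.mark_ne i (Equiv.Perm.SameCycle.eq_of_right h H.fix)

theorem edge_mem_iff (i : Fin (s + 1)) :
    z ∈ my.lightFace (my.mark i) ↔ σ c ∈ mx.lightFace (mx.mark i.succ) := by
  rw [H.mem_lightFace_iff, if_pos rfl]

theorem ncard_lightFace [Finite E] (i : Fin (s + 1)) : (my.lightFace (my.mark i)).ncard
    = (mx.lightFace (mx.mark i.succ)).ncard
      + Set.ncard {u | u = z ∧ σ c ∈ mx.lightFace (mx.mark i.succ)} := by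
  have hz : z ∉ σ ⁻¹' mx.lightFace (mx.mark i.succ) := by
    rw [Set.mem_preimage, H.apply_edge]
    exact H.zero_notMem_lightFace i
  have h₁ : my.lightFace (my.mark i) = σ ⁻¹' mx.lightFace (mx.mark i.succ)
      ∪ {u | u = z ∧ σ c ∈ mx.lightFace (mx.mark i.succ)} := by
    ext u
    rw [H.mem_lightFace_iff]
    rcases eq_or_ne u z with rfl | hu
    · simp only [if_pos, Set.mem_union, Set.mem_ofPred_eq, true_and]
      tauto
    · simp [hu]
  have hdisj : Disjoint (σ ⁻¹' mx.lightFace (mx.mark i.succ))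
      {u | u = z ∧ σ c ∈ mx.lightFace (mx.mark i.succ)} := by
    rw [Set.disjoint_left]
    rintro u hu ⟨rfl, _⟩
    exact hz hu
  rw [h₁, Set.ncard_union_eq hdisj, Set.ncard_preimage_of_injective_subset_range σ.injective]
  simp [σ.surjective.range_eq]

theorem ncard_lightFace_of_mem [Finite E] {i : Fin (s + 1)}
    (hi : σ c ∈ mx.lightFace (mx.mark i.succ)) :
    (my.lightFace (my.mark i)).ncard = (mx.lightFace (mx.mark i.succ)).ncard + 1 := by
  rw [H.ncard_lightFace]
  simp [hi]

theorem ncard_lightFace_of_notMem [Finite E] {i : Fin (s + 1)}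
    (hi : σ c ∉ mx.lightFace (mx.mark i.succ)) :
    (my.lightFace (my.mark i)).ncard = (mx.lightFace (mx.mark i.succ)).ncard := by
  rw [H.ncard_lightFace]
  simp [hi]

/-- An equivalence is needed: suppression and addition read the same insertion in opposite
directions. -/
theorem marked_iff : (∀ u, ∃! i, u ∈ mx.lightFace (mx.mark i))
    ↔ ∀ u, ∃! i, u ∈ my.lightFace (my.mark i) := by
  constructor
  · intro h u
    obtain ⟨i, hi, hi'⟩ := h (σ (if u = z then c else u))
    cases i using Fin.cases with
    | zero =>
      rw [H.mem_lightFace_zero_iff, ← H.apply_edge] at hi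
      have := σ.injective hi
      split_ifs at this with hu
      · exact absurd this H.corner_ne
      · exact absurd this hu
    | succ i =>
      refine ⟨i, (H.mem_lightFace_iff i u).2 hi, fun j hj => ?_⟩
      exact Fin.succ_injective _ (hi' _ ((H.mem_lightFace_iff j u).1 hj))
  · intro h v
    rcases eq_or_ne v (mx.mark 0) with rfl | hv
    · refine ⟨0, Equiv.Perm.SameCycle.refl _ _, fun j hj => ?_⟩
      cases j using Fin.cases with
      | zero => rfl
      | succ j => exact absurd hj (H.zero_notMem_lightFace j)
    · have hmem : ∀ i, σ⁻¹ v ∈ my.lightFace (my.mark i) ↔ v ∈ mx.lightFace (mx.mark i.succ) := by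
        intro i
        rw [H.mem_lightFace_iff, if_neg, Equiv.Perm.apply_inv_apply]
        intro h
        rw [← H.apply_edge, ← h, Equiv.Perm.apply_inv_apply] at hv
        exact hv rfl
      obtain ⟨i, hi, hi'⟩ := h (σ⁻¹ v)
      refine ⟨i.succ, (hmem i).1 hi, fun j hj => ?_⟩
      cases j using Fin.cases with
      | zero => exact absurd ((H.mem_lightFace_zero_iff v).1 hj) hv
      | succ j => rw [hi' j ((hmem j).2 hj)]

/-- The effect of the insertion of a side on the degrees of the light faces. -/
theorem hasType_iff [Finite E] {a : Fin (s + 2) → ℕ} {b : Fin (s + 1) → ℕ} (ha_one : a 0 = 1)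
    (hb_zero : b 0 = a 1 + 1) (hb_succ : ∀ i : Fin s, b i.succ = a i.succ.succ)
    (hmarked : ∀ u, ∃! i, u ∈ mx.lightFace (mx.mark i)) (hc : σ c ∈ mx.lightFace (mx.mark 1)) :
    mx.HasType a ↔ my.HasType b := by
  have h₀ : (mx.lightFace (mx.mark 0)).ncard = 1 := by
    rw [Set.ncard_eq_one]
    exact ⟨mx.mark 0, Set.ext fun u => H.mem_lightFace_zero_iff u⟩
  have h₁ := H.ncard_lightFace_of_mem (i := 0) hc
  have h₂ : ∀ i : Fin s, (my.lightFace (my.mark i.succ)).ncard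
      = (mx.lightFace (mx.mark i.succ.succ)).ncard := fun i =>
    -- A face has only one number, so the corner that lies in the face number `1` lies in no other.
    H.ncard_lightFace_of_notMem fun h => by
      have := (hmarked _).unique hc h
      rw [← Fin.succ_zero_eq_one] at this
      exact absurd (Fin.succ_injective _ this) (Fin.succ_ne_zero i).symm
  have h₃ : (0 : Fin (s + 1)).succ = 1 := Fin.succ_zero_eq_one
  rw [h₃] at h₁
  constructor
  · intro h i
    cases i using Fin.cases with
    | zero => rw [h₁, h 1, hb_zero]
    | succ i => rw [h₂, h, hb_succ]
  · intro h i
    cases i using Fin.cases with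
    | zero => rw [h₀, ha_one]
    | succ i =>
      cases i using Fin.cases with
      | zero =>
        rw [h₃]
        have := h 0
        omega
      | succ i => rw [← h₂, h, hb_succ]

end IsInsertion

omit [DecidableEq E] in
-- This makes the number of light faces in the Euler relation depend only on the index type of the
-- marks.
theorem ncard_range_lightFace {ι : Type*} {m : PreHypermap E ι}
    (h : ∀ u, ∃! i, u ∈ m.lightFace (m.mark i)) :
    (Set.range m.lightFace).ncard = Nat.card ι := by
  have heq : ∀ u v, v ∈ m.lightFace u → m.lightFace v = m.lightFace u := fun u v hv =>
    (Equiv.Perm.cycleSet_eq_iff (g := m.light)).2 (Equiv.Perm.SameCycle.symm hv)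
  have hr : Set.range m.lightFace = Set.range fun i => m.lightFace (m.mark i) := by
    ext C
    constructor
    · rintro ⟨u, rfl⟩
      obtain ⟨i, hi, _⟩ := h u
      exact ⟨i, (heq _ _ hi).symm⟩
    · rintro ⟨i, rfl⟩
      exact ⟨_, rfl⟩
  rw [hr, ← Nat.card_coe_set_eq, Nat.card_range_of_injective]
  intro i j hij
  refine (h (m.mark i)).unique (Equiv.Perm.SameCycle.refl _ _) ?_
  simp only at hij
  rw [← hij]
  exact Equiv.Perm.SameCycle.refl _ _

end PreHypermap

end InsertSide

/-! ### The paths followed by the two operations -/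

namespace PreHypermap

variable {E ι : Type*} {m : PreHypermap E ι} {O : EdgeOrientation}

/-- The successive edges found when one follows a lightest geodesic. -/
noncomputable def lightestPath (m : PreHypermap E ι) (O : EdgeOrientation) (v : Set E) (e₀ : E)
    (i : ℕ) : E := (m.lightestEdge O v)^[i] e₀

theorem lightestPath_succ (v : Set E) (e₀ : E) (i : ℕ) :
    m.lightestPath O v e₀ (i + 1) = m.lightestEdge O v (m.lightestPath O v e₀ i) :=
  Function.iterate_succ_apply' _ _ _

theorem cons_lightestSteps (v : Set E) (k : ℕ) (e₀ : E) :
    e₀ :: m.lightestSteps O v k e₀ = (List.range (k + 1)).map (m.lightestPath O v e₀) := by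
  induction k generalizing e₀ with
  | zero => rfl
  | succ k ih =>
    rw [lightestSteps, ih, List.range_succ_eq_map (n := k + 1), List.map_cons, List.map_map]
    rfl

/-- A first descent puts no constraint on `n` at the last index. Its value there is left free as
`N`, because the two operations choose different last sectors. -/
theorem Connected.isFirstDescent [Finite E] (hm : m.Connected) (t e₀ : E) (N : ℕ) :
    ∃ n : ℕ → ℕ, n (m.dist O (m.head O e₀) (m.tail O t)) = N ∧
      IsFirstDescent (m.lightNext O) (m.darkNext O)
        (fun y => m.dist O (m.tail O y) (m.tail O t)) (m.lightestPath O (m.tail O t) e₀) n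
        (m.dist O (m.head O e₀) (m.tail O t)) := by
  rw [head_eq_tail_lightNext]
  set v := m.tail O t with hv
  set e := m.lightestPath O v e₀ with he
  set k := m.dist O (m.tail O (m.lightNext O e₀)) v with hk
  have hend : ∀ i ≤ k, m.dist O (m.tail O (m.lightNext O (e i))) v + i = k := by
    intro i
    induction i with
    | zero => exact fun _ => rfl
    | succ i ih =>
      intro hi
      have h₁ := ih (by omega)
      obtain ⟨_, _, h₂, _⟩ := hm.lightestEdge_spec (O := O) (e := e i) (t := t) (by
        rw [← hv]
        omega)
      rw [← hv, he, ← lightestPath_succ, ← he] at h₂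
      omega
  have hspec : ∀ i, ∃ r, i < k → e (i + 1) = (m.rot O ^ r) (m.lightNext O (e i)) ∧
      ∀ j < r, m.dist O (m.tail O (m.lightNext O ((m.rot O ^ j) (m.lightNext O (e i))))) v + 1
        ≠ m.dist O (m.tail O (m.lightNext O (e i))) v := by
    intro i
    by_cases hi : i < k
    · obtain ⟨r, h₁, _, h₂⟩ := hm.lightestEdge_spec (O := O) (e := e i) (t := t) (by
        have := hend i hi.le
        rw [← hv]
        omega)
      rw [← hv, he, ← lightestPath_succ, ← he] at h₁
      exact ⟨r, fun _ => ⟨h₁, h₂⟩⟩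
    · exact ⟨0, fun h => absurd h hi⟩
  choose r hr using hspec
  refine ⟨fun i => if i = k then N else r i, if_pos rfl, fun y => ?_, fun y =>
    hm.dist_le_add_one y t, hend, fun i hi => ?_, fun i hi j hj => ?_⟩
  · rw [← head_eq_tail_lightNext, head_eq_tail_darkNext]
  · simp only [if_neg hi.ne]
    exact (hr i hi).1.symm
  · simp only [if_neg hi.ne] at hj
    exact (hr i hi).2 j hj

/-- The edge that follows, in the contour of its light face in the orientation `O`, the corner that
precedes the edge `c` in the light-left orientation. -/
def cornerNext (m : PreHypermap E ι) : EdgeOrientation → E → E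
  | .lightLeft, c => c
  | .lightRight, c => m.light⁻¹ c

theorem tail_cornerNext (c : E) : m.tail O (m.cornerNext O c) = m.vertexOf c := by
  cases O
  · rfl
  · exact congrArg m.vertexOf (m.light.apply_inv_apply c)

theorem cornerNext_ne {c e : E} (hfix : m.light e = e) (hc : c ≠ e) : m.cornerNext O c ≠ e := by
  cases O
  · exact hc
  · intro h
    refine hc ?_
    rw [← m.light.apply_inv_apply c, ← hfix]
    exact congrArg m.light h

/-- The path that is followed by `suppress`. -/
theorem Connected.isSuppressPath [Finite E] (hm : m.Connected) {e₀ c : E}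
    (hfix : m.light e₀ = e₀) (hc : c ≠ e₀) :
    ∃ n : ℕ → ℕ, IsSuppressPath (m.lightNext O) (m.darkNext O)
      (fun y => m.dist O (m.tail O y) (m.vertexOf c)) (m.lightestPath O (m.vertexOf c) e₀) n
      (m.dist O (m.head O e₀) (m.vertexOf c)) (m.cornerNext O c) := by
  classical
  rw [← tail_cornerNext (O := O)]
  set t := m.cornerNext O c with ht
  set e := m.lightestPath O (m.tail O t) e₀
  set k := m.dist O (m.head O e₀) (m.tail O t)
  -- The path ends at the target vertex, so turning there eventually meets the corner; the first
  -- time it does delimits the last sector.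
  have hex : ∃ j, (m.rot O ^ j) (m.lightNext O (e k)) = t := by
    obtain ⟨n, _, H⟩ := hm.isFirstDescent (O := O) t e₀ 0
    have h₁ := H.label_end k le_rfl
    have h₂ := hm.tail_eq_of_dist_eq_zero (O := O) (e := m.lightNext O (e k)) (e' := t)
      (Nat.add_eq_right.1 h₁)
    obtain ⟨j, hj⟩ := ((m.tail_eq_tail_iff O).1 h₂).exists_nat_pow_eq
    exact ⟨j, hj⟩
  obtain ⟨n, hn, H⟩ := hm.isFirstDescent (O := O) t e₀ (Nat.find hex)
  refine ⟨n, H, ?_, cornerNext_ne hfix hc, dist_self _, ?_, ?_⟩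
  · cases O
    · exact hfix
    · exact m.light.injective ((m.light.apply_inv_apply _).trans hfix.symm)
  · rw [hn]
    exact Nat.find_spec hex
  · intro j hj
    rw [hn] at hj
    exact Nat.find_min hex hj

/-- The path that is followed by `addFace`. -/
theorem Connected.isAddPath [Finite E] (hm : m.Connected) {e₀ t : E}
    (hleave : m.dist O (m.tail O e₀) (m.tail O t) = m.dist O (m.head O e₀) (m.tail O t) + 1) :
    ∃ n : ℕ → ℕ, IsAddPath (m.lightNext O) (m.darkNext O)
      (fun y => m.dist O (m.tail O y) (m.tail O t)) (m.lightestPath O (m.tail O t) e₀) n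
      (m.dist O (m.head O e₀) (m.tail O t)) := by
  classical
  set e := m.lightestPath O (m.tail O t) e₀
  set k := m.dist O (m.head O e₀) (m.tail O t)
  -- The least positive number of turns that returns to the starting edge makes the last sector a
  -- complete vertex.
  have hex : ∃ j, 0 < j ∧ (m.rot O ^ j) (m.lightNext O (e k)) = m.lightNext O (e k) :=
    ⟨orderOf (m.rot O), orderOf_pos _, by rw [pow_orderOf_eq_one, Equiv.Perm.one_apply]⟩
  obtain ⟨n, hn, H⟩ := hm.isFirstDescent (O := O) t e₀ (Nat.find hex)
  refine ⟨n, H, hleave, ?_, ?_, ?_⟩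
  · rw [hn]
    exact (Nat.find_spec hex).1
  · rw [hn]
    exact (Nat.find_spec hex).2
  · intro j hj hj' h
    rw [hn] at hj
    exact Nat.find_min hex hj ⟨hj', h⟩

end PreHypermap

/-! ### The two operations on labelled maps, and their composites. -/

section Operations

variable {E ι : Type*}

/-- Raised labels are needed here: since `e 0` is a loop, it has the same plain label as `e 1`. -/
theorem IsSuppressPath.path_inj {l d : Equiv.Perm E} {f : E → ℕ} {e : ℕ → E} {n : ℕ → ℕ} {k : ℕ}
    {b : E} (H : IsSuppressPath l d f e n k b) (i : ℕ) (hi : i ≤ k) (j : ℕ) (hj : j ≤ k)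
    (h : e i = e j) : i = j := by
  have key : ∀ i ≤ k, raise f (sector l d e n k) (e i) + i = k + 1 := by
    intro i hi
    cases i with
    | zero => exact H.raise_zero
    | succ i => exact H.raise_succ hi
  have h₁ := key i hi
  have h₂ := key j hj
  rw [h] at h₁
  omega

theorem getLastD_of_cons_eq_map_range {e : ℕ → E} {k : ℕ} {a : E} {L : List E}
    (h : a :: L = (List.range (k + 1)).map e) : L.getLastD a = e k := by
  have h₁ := congrArg List.getLast? h
  rw [List.range_succ, List.map_append, List.getLast?_append] at h₁
  simpa [List.getLast?_cons, List.getLastD_eq_getLast?] using h₁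

theorem headD_reverse_map_range (e : ℕ → E) (k : ℕ) (a : E) :
    ((List.range (k + 1)).map e).reverse.headD a = e k := by
  simp [List.range_succ]

theorem getLastD_reverse_map_range (e : ℕ → E) (k : ℕ) (a : E) :
    ((List.range (k + 1)).map e).reverse.getLastD a = e 0 := by
  simp [List.getLastD_eq_getLast?, List.range_succ_eq_map]

variable [DecidableEq E]

theorem CornerMap.cornerEdge_slide (L : List E) (x : CornerMap E ι) :
    (x.slide L).cornerEdge = L.formPerm⁻¹ x.cornerEdge := by
  rcases h : x.corner <;> simp [cornerEdge, slide, h]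

/-- In the reverse contour, insertion before `c` becomes insertion before `light⁻¹ c`, as `e₀` is a
fixed point. One formula thus covers both orientations. -/
theorem PreHypermap.lightNext_of_insert {κ : Type*} {m : PreHypermap E ι} {m' : PreHypermap E κ}
    {σ : Equiv.Perm E} {z e₀ c : E} (O : EdgeOrientation) (hz : σ z = e₀) (hfix : m.light e₀ = e₀)
    (h : m'.light = Equiv.swap z (σ⁻¹ c) * (σ⁻¹ * m.light * σ)) :
    m'.lightNext O = σ⁻¹ * Equiv.swap e₀ (m.cornerNext O c) * m.lightNext O * σ := by
  have hz' : z = σ⁻¹ e₀ := by rw [← hz, Equiv.Perm.inv_apply_apply]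
  have hfix' : m.light⁻¹ e₀ = e₀ := by
    conv_lhs => rw [← hfix, Equiv.Perm.inv_apply_apply]
  rw [hz', ← mul_assoc, ← mul_assoc, ← Equiv.mul_swap_eq_swap_mul] at h
  cases O
  · exact h
  · simp only [lightNext, cornerNext, h, mul_inv_rev, inv_inv, Equiv.swap_inv]
    have := Equiv.mul_swap_eq_swap_mul m.light⁻¹ e₀ c
    rw [hfix'] at this
    rw [mul_assoc σ⁻¹, ← this]
    simp only [mul_assoc]

theorem PreHypermap.lightNext_of_remove {κ : Type*} {m : PreHypermap E ι} {m' : PreHypermap E κ}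
    {σ : Equiv.Perm E} {z : E} (O : EdgeOrientation)
    (h : m'.light = σ⁻¹ * (Equiv.swap z (m.light z) * m.light) * σ) :
    m'.lightNext O = σ⁻¹ * Equiv.swap z (m.lightNext O z) * m.lightNext O * σ := by
  cases O
  · simp only [lightNext, h, mul_assoc]
  · have : m.light⁻¹ * Equiv.swap z (m.light z) = Equiv.swap z (m.light⁻¹ z) * m.light⁻¹ := by
      rw [Equiv.mul_swap_eq_swap_mul, Equiv.Perm.inv_apply_apply, Equiv.swap_comm]
    simp only [lightNext, h, mul_inv_rev, inv_inv, Equiv.swap_inv]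
    rw [mul_assoc σ⁻¹, ← this]
    simp only [mul_assoc]

/-- A corner is recorded by the edge that follows it for light-left, whereas the path lives in the
orientation `O`; the vertex of the corner left by the removed side can be read either way. -/
theorem PreHypermap.vertexOf_corner_of_remove {κ : Type*} {m : PreHypermap E ι}
    {m' : PreHypermap E κ} {σ : Equiv.Perm E} {z : E} (O : EdgeOrientation)
    (h : m'.light = σ⁻¹ * (Equiv.swap z (m.light z) * m.light) * σ) :
    m'.vertexOf (σ⁻¹ (m.light z)) = m'.tail O (σ⁻¹ (m.lightNext O z)) := by
  cases O
  · rfl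
  · have : σ⁻¹ (m.light z) = m'.light (σ⁻¹ (m.light⁻¹ z)) := by
      rw [h]
      simp only [Equiv.Perm.mul_apply, Equiv.Perm.apply_inv_apply, Equiv.swap_apply_left]
    rw [this]
    rfl

theorem PreHypermap.removeSide_corner_of_exists {m : PreHypermap E ι} {z : E}
    (h : ∃ i, m.mark i = m.light z) :
    ∃ i, m.mark i = m.light z ∧ (m.removeSide z).corner = Sum.inr i :=
  ⟨h.choose, h.choose_spec, by rw [removeSide, dif_pos h]⟩

theorem PreHypermap.removeSide_corner_of_not_exists {m : PreHypermap E ι} {z : E}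
    (h : ¬ ∃ i, m.mark i = m.light z) : (m.removeSide z).corner = Sum.inl (m.light z) := by
  rw [removeSide, dif_neg h]

variable [Finite E] {s : ℕ}

/-- The properties of the suppression of a face of degree one. -/
theorem CornerMap.suppress_spec (O : EdgeOrientation) (x : CornerMap E (Fin (s + 2)))
    (hm : x.map.Connected) (hfix : x.map.light (x.map.mark 0) = x.map.mark 0)
    (hinj : Function.Injective x.map.mark) (hc : x.cornerEdge ≠ x.map.mark 0)
    (hc' : x.corner ≠ Sum.inr 0) :
    (x.suppress O).addFace O = x ∧ (x.suppress O).map.Connected ∧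
      (Set.range (x.suppress O).map.vertexOf).ncard = (Set.range x.map.vertexOf).ncard + 1 ∧
      (x.suppress O).vertex ∈ Set.range (x.suppress O).map.vertexOf ∧
      (x.suppress O).map.IsLeaving O.rev (x.suppress O).vertex (x.suppress O).edge ∧
      ∃ σ : Equiv.Perm E, x.map.IsInsertion (x.suppress O).map σ (x.suppress O).edge
        (σ⁻¹ x.cornerEdge) := by
  classical
  obtain ⟨n, H⟩ := hm.isSuppressPath (O := O.rev) hfix hc
  set d₀ := x.map.mark 0 with hd₀
  set c := x.cornerEdge with hcE
  set v := x.cornerVertex with hv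
  have hv' : x.map.vertexOf c = v := rfl
  rw [hv'] at H
  set e := x.map.lightestPath O.rev v d₀ with he
  set k := x.map.dist O.rev (x.map.head O.rev d₀) v with hk
  have hlist : d₀ :: x.map.lightestGeodesic O.rev d₀ v = (List.range (k + 1)).map e :=
    PreHypermap.cons_lightestSteps v k d₀
  have he0 : e 0 = d₀ := rfl
  have hlast : (x.map.lightestGeodesic O.rev d₀ v).getLastD d₀ = e k :=
    getLastD_of_cons_eq_map_range hlist
  set L := (List.range (k + 1)).map e with hL
  set σ := L.formPerm with hσdef
  have hσ : IsShift σ e k := isShift_formPerm H.path_inj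
  have hσz : σ (e k) = d₀ := hσ.apply_last
  have hck : σ⁻¹ c ≠ e k := fun h => hc (by
    rw [← hσz, ← h, Equiv.Perm.apply_inv_apply])
  have hslide : (x.slide L).cornerEdge = σ⁻¹ c := x.cornerEdge_slide L
  set y := x.suppress O with hy
  have hylight : y.map.light = Equiv.swap (e k) (σ⁻¹ c) * (σ⁻¹ * x.map.light * σ) := by
    rw [hy, CornerMap.suppress]
    simp only [← hd₀, ← hv, hlist, hlast, insertSide, hslide]
    rfl
  have hydark : y.map.dark = x.map.dark := rfl
  have hyedge : y.edge = e k := hlast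
  have hyvertex : y.vertex = y.map.tail O.rev (e 0) := rfl
  have hymark : ∀ i, y.map.mark i = Sum.elim
      (fun q => if σ⁻¹ (x.map.mark i.succ) = σ⁻¹ q then e k else σ⁻¹ (x.map.mark i.succ))
      (fun _ => σ⁻¹ (x.map.mark i.succ)) x.corner := by
    intro i
    rw [hy, CornerMap.suppress]
    simp only [← hd₀, ← hv, hlist, hlast, insertSide]
    rcases hcor : x.corner with q | j <;> simp only [slide, hcor] <;> rfl
  have hmk : ∀ i : Fin (s + 1), σ⁻¹ (x.map.mark i.succ) ≠ e k := fun i h => by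
    have : x.map.mark i.succ = d₀ := by rw [← hσz, ← h, Equiv.Perm.apply_inv_apply]
    exact Fin.succ_ne_zero i (hinj this)
  have hfixk : (σ⁻¹ * x.map.light * σ) (e k) = e k := by
    rw [Equiv.Perm.mul_apply, Equiv.Perm.mul_apply, hσz, hfix, ← hσz, Equiv.Perm.inv_apply_apply]
  have hyk : y.map.light (e k) = σ⁻¹ c := by
    rw [hylight, Equiv.Perm.mul_apply, hfixk, Equiv.swap_apply_left]
  have hyl : y.map.lightNext O.rev = σ⁻¹ * Equiv.swap (e 0) (x.map.cornerNext O.rev c)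
      * x.map.lightNext O.rev * σ := PreHypermap.lightNext_of_insert O.rev hσz hfix hylight
  have hyd : y.map.darkNext O.rev = x.map.darkNext O.rev := by cases O <;> rfl
  have S := H.isSewn hσ
  set h := raise (fun u => x.map.dist O.rev (x.map.tail O.rev u) v)
    (sector (x.map.lightNext O.rev) (x.map.darkNext O.rev) e n k) with hh
  rw [← hyl, ← hyd] at S
  have hyconn : y.map.Connected := by
    refine hm.of_isSewn hyd hyl hσ S fun r hr _ hpath _ => ?_
    refine r.trans (hpath k le_rfl) ?_
    have h₁ := hr (e k)
    rw [hyl, H.sew_last hσ] at h₁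
    exact h₁
  have hdk : y.map.dist O.rev y.vertex (y.map.tail O.rev (e k)) = k := by
    rw [hyvertex]
    exact hyconn.isSewn_dist S le_rfl
  have hdk' : y.map.dist O.rev y.vertex (y.map.head O.rev (e k)) = k + 1 := by
    apply le_antisymm
    · have hp := (PreHypermap.isSewn_isPath S k le_rfl).append
        (l' := [e k]) (w := y.map.head O.rev (e k)) ⟨rfl, rfl⟩
      rw [hyvertex]
      simpa using PreHypermap.dist_le_length hp
    -- The raised label is `k + 1` at the origin of `e 0` and `0` at the end of `e k`.
    · have h₁ := hyconn.le_dist_add S.label_eq S.label_le (e 0) (y.map.darkNext O.rev (e k))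
      have h₂ := S.label_path 0 (Nat.zero_le _)
      have h₃ : h (x.map.darkNext O.rev (e k)) = 0 := by
        rw [hh, raise_of_notMem (H.dark_notMem le_rfl), ← H.label_eq]
        exact Nat.add_eq_right.1 (H.label_end k le_rfl)
      rw [← PreHypermap.head_eq_tail_darkNext, ← hyvertex, hyd, h₃] at h₁
      omega
  -- From the corner preceding `e k`, the turn number `0` is `e k` itself and it already goes
  -- closer, so it is the first edge. The other `k` edges are the path found back in reverse order.
  have hgeo : y.map.lightestGeodesic O ((y.map.lightNext O)⁻¹ y.edge) y.vertex = L.reverse := by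
    have hstart : y.map.head O ((y.map.lightNext O)⁻¹ y.edge) = y.map.head O.rev (e k) := by
      rw [PreHypermap.head_eq_tail_lightNext, Equiv.Perm.apply_inv_apply, hyedge,
        PreHypermap.head_rev]
    have hd : y.map.dist O (y.map.head O.rev (e k)) y.vertex = k + 1 := by
      rw [← PreHypermap.dist_rev, hdk']
    have hd' : y.map.dist O (y.map.head O (e k)) y.vertex = k := by
      rw [← PreHypermap.dist_rev, ← PreHypermap.tail_rev, hdk]
    have hturn : y.map.turn O ((y.map.lightNext O)⁻¹ y.edge) 0 = e k := by
      rw [PreHypermap.turn_eq, pow_zero, Equiv.Perm.one_apply, Equiv.Perm.apply_inv_apply, hyedge]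
    have hfirst : y.map.lightestEdge O y.vertex ((y.map.lightNext O)⁻¹ y.edge) = e k := by
      have : sInf {i | y.map.dist O (y.map.head O (y.map.turn O ((y.map.lightNext O)⁻¹ y.edge) i))
          y.vertex + 1 = y.map.dist O (y.map.head O ((y.map.lightNext O)⁻¹ y.edge)) y.vertex}
          = 0 := by
        refine Nat.sInf_eq_zero.2 (Or.inl ?_)
        rw [Set.mem_ofPred_eq, hturn, hstart, hd, hd']
      rw [PreHypermap.lightestEdge, this, hturn]
    rw [PreHypermap.lightestGeodesic, hstart, hd, PreHypermap.lightestSteps, hfirst, hL,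
      List.range_succ, List.map_append, List.reverse_append, hyvertex]
    have := hyconn.isSewn_lightestSteps S k le_rfl
    rw [O.rev_rev] at this
    rw [this]
    rfl
  -- Removing the inserted side puts all the marks back, including one that the insertion had moved
  -- to `e k`.
  have hrem : ∀ i, (if y.map.mark i = e k then y.map.light (e k) else y.map.mark i)
      = σ⁻¹ (x.map.mark i.succ) := by
    intro i
    have hmi := hymark i
    rcases hcor : x.corner with q | j
    · have hcq : c = q := by rw [hcE, cornerEdge, hcor]; rfl
      rw [hcor, Sum.elim_inl] at hmi
      by_cases hq : σ⁻¹ (x.map.mark i.succ) = σ⁻¹ q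
      · rw [if_pos hq] at hmi
        rw [if_pos hmi, hyk, hcq, hq]
      · rw [if_neg hq] at hmi
        rw [hmi, if_neg (hmk i)]
    · rw [hcor, Sum.elim_inr] at hmi
      rw [hmi, if_neg (hmk i)]
  -- Reversing the list inverts its cyclic shift, so the second slide cancels the first.
  have hinvσ : (L.reverse.formPerm)⁻¹ = σ := by rw [List.formPerm_reverse, inv_inv]
  have hadd : y.addFace O = x := by
    rw [VertexEdgeMap.addFace]
    simp only [hgeo, hL, headD_reverse_map_range, getLastD_reverse_map_range]
    rw [← hL]
    ext1
    · ext1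
      · simp only [slide, PreHypermap.removeSide, hinvσ]
        rw [hyk, hylight, Equiv.swap_mul_self_mul, List.formPerm_reverse, ← hσdef]
        group
      · rfl
      · funext i
        cases i using Fin.cases with
        | zero => rfl
        | succ i =>
          simp only [slide, PreHypermap.removeSide, hinvσ, Fin.cons_succ]
          rw [hrem, Equiv.Perm.apply_inv_apply]
    · simp only [slide, hinvσ]
      -- The side of the mark on which the corner lay can be recovered: a mark stands in the corner
      -- that follows the inserted side exactly when the distinguished corner was before the mark.
      rcases hcor : x.corner with q | j
      · have hcq : c = q := by rw [hcE, cornerEdge, hcor]; rfl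
        have hno : ¬ ∃ i, y.map.mark i = y.map.light (e k) := by
          rintro ⟨i, hi⟩
          rw [hyk, hymark, hcor, Sum.elim_inl, hcq] at hi
          split_ifs at hi with hq
          · rw [hcq] at hck
            exact hck hi.symm
          · exact hq hi
        rw [PreHypermap.removeSide_corner_of_not_exists hno, hyk, hcq]
        simp only [Sum.map_inl, id, Equiv.Perm.apply_inv_apply]
      · cases j using Fin.cases with
        | zero => exact absurd hcor hc'
        | succ j =>
          have hcj : c = x.map.mark j.succ := by rw [hcE, cornerEdge, hcor]; rfl
          have hyes : ∃ i, y.map.mark i = y.map.light (e k) := by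
            refine ⟨j, ?_⟩
            rw [hyk, hymark, hcor, Sum.elim_inr, hcj]
          obtain ⟨i, h₁, h₂⟩ := PreHypermap.removeSide_corner_of_exists hyes
          rw [h₂]
          rw [hyk, hymark, hcor, Sum.elim_inr, hcj] at h₁
          have h₃ := hinj (σ⁻¹.injective h₁)
          simp only [Sum.map_inr, id, h₃]
  refine ⟨hadd, hyconn, ?_, ?_, ?_, σ, ⟨?_, ?_, hfix, ?_, ?_, ?_⟩⟩
  · rw [y.map.ncard_range_vertexOf O.rev, x.map.ncard_range_vertexOf O.rev]
    have := H.ncard_range_cycleSet hσ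
    rw [← hyl, ← hyd] at this
    rw [PreHypermap.rot, PreHypermap.rot, this, hyd]
  · rw [hyvertex]
    cases O
    · exact ⟨_, rfl⟩
    · exact ⟨_, rfl⟩
  · rw [PreHypermap.IsLeaving, hyedge, hdk, hdk']
  · rw [hyedge, hylight]
  · rw [hyedge, hσz]
  · rw [hyedge]
    exact hck
  · intro i
    rw [← hrem i]
    split_ifs with h
    · rw [h, Equiv.Perm.sameCycle_apply_right]
    · exact Equiv.Perm.SameCycle.refl _ _
  · exact fun i h => Fin.succ_ne_zero i (hinj h)

/-- The properties of the addition of a face of degree one. -/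
theorem VertexEdgeMap.addFace_spec (O : EdgeOrientation) (y : VertexEdgeMap E (Fin (s + 1)))
    (hm : y.map.Connected) (hne : y.map.light y.edge ≠ y.edge)
    (hmarked : ∀ u, ∃! i, u ∈ y.map.lightFace (y.map.mark i))
    (hv : y.vertex ∈ Set.range y.map.vertexOf) (hleave : y.map.IsLeaving O.rev y.vertex y.edge) :
    (y.addFace O).suppress O = y ∧ (y.addFace O).map.Connected ∧
      ∃ σ : Equiv.Perm E, (y.addFace O).map.IsInsertion y.map σ y.edge
        (σ⁻¹ (y.addFace O).cornerEdge) ∧ (∀ j, (y.addFace O).corner = Sum.inr j →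
          y.edge ∈ y.map.lightFace (y.map.mark 0) → j = 1) := by
  classical
  obtain ⟨t, ht⟩ : ∃ t, y.vertex = y.map.tail O t := by
    obtain ⟨t, ht⟩ := hv
    cases O
    · exact ⟨t, ht.symm⟩
    · exact ⟨y.map.light⁻¹ t, by
        rw [← ht]
        exact congrArg y.map.vertexOf (y.map.light.apply_inv_apply t).symm⟩
  rw [PreHypermap.IsLeaving, PreHypermap.dist_rev, PreHypermap.dist_rev, PreHypermap.head_rev,
    PreHypermap.tail_rev, ht] at hleave
  obtain ⟨n, H⟩ := hm.isAddPath hleave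
  set v := y.map.tail O t with hvdef
  set z := y.edge with hz
  set e := y.map.lightestPath O v z with he
  set k := y.map.dist O (y.map.head O z) v with hk
  have he0 : e 0 = z := rfl
  set L := (List.range (k + 1)).map e with hL
  set σ := L.formPerm with hσdef
  have hσ : IsShift σ e k := isShift_formPerm fun i hi j hj => H.path_inj hi hj
  have hgeo : y.map.lightestGeodesic O ((y.map.lightNext O)⁻¹ z) v = L := by
    have hstart : y.map.head O ((y.map.lightNext O)⁻¹ z) = y.map.tail O z := by
      rw [PreHypermap.head_eq_tail_lightNext, Equiv.Perm.apply_inv_apply]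
    have hturn : y.map.turn O ((y.map.lightNext O)⁻¹ z) 0 = z := by
      rw [PreHypermap.turn_eq, pow_zero, Equiv.Perm.one_apply, Equiv.Perm.apply_inv_apply]
    have hfirst : y.map.lightestEdge O v ((y.map.lightNext O)⁻¹ z) = z := by
      have : sInf {i | y.map.dist O (y.map.head O (y.map.turn O ((y.map.lightNext O)⁻¹ z) i)) v + 1
          = y.map.dist O (y.map.head O ((y.map.lightNext O)⁻¹ z)) v} = 0 := by
        refine Nat.sInf_eq_zero.2 (Or.inl ?_)
        rw [Set.mem_ofPred_eq, hturn, hstart, hleave]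
      rw [PreHypermap.lightestEdge, this, hturn]
    rw [PreHypermap.lightestGeodesic, hstart, hleave, PreHypermap.lightestSteps, hfirst,
      PreHypermap.cons_lightestSteps]
  have hlist : z :: y.map.lightestSteps O v k z = L := PreHypermap.cons_lightestSteps v k z
  have hhead : L.headD z = z := by rw [← hlist]; rfl
  have hlast : L.getLastD z = e k := by
    have := getLastD_of_cons_eq_map_range hlist
    rw [← hlist]
    exact List.getLastD_cons.trans this
  set x := y.addFace O with hx
  have hxdef : x = ⟨⟨((y.map.removeSide z).slide L).map.light, y.map.dark,
      Fin.cons (e k) ((y.map.removeSide z).slide L).map.mark⟩,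
      Sum.map id Fin.succ ((y.map.removeSide z).slide L).corner⟩ := by
    rw [hx, VertexEdgeMap.addFace]
    simp only [← hz, ht, hgeo, hhead, hlast]
    rfl
  have hxlight : x.map.light = σ⁻¹ * (Equiv.swap z (y.map.light z) * y.map.light) * σ := by
    rw [hxdef]
    rfl
  have hxdark : x.map.dark = y.map.dark := rfl
  have hxmark0 : x.map.mark 0 = e k := by
    rw [hxdef]
    rfl
  have hxmark : ∀ i : Fin (s + 1), x.map.mark i.succ
      = σ⁻¹ (if y.map.mark i = z then y.map.light z else y.map.mark i) := by
    intro i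
    rw [hxdef]
    rfl
  have hR : ∀ i : Fin (s + 1), (y.map.mark i = z ∧ σ (x.map.mark i.succ) = y.map.light z) ∨
      (y.map.mark i ≠ z ∧ σ (x.map.mark i.succ) = y.map.mark i) := by
    intro i
    rw [hxmark, Equiv.Perm.apply_inv_apply]
    by_cases hi : y.map.mark i = z
    · exact Or.inl ⟨hi, if_pos hi⟩
    · exact Or.inr ⟨hi, if_neg hi⟩
  have hxcorner : (∃ i : Fin (s + 1), y.map.mark i = y.map.light z ∧ x.corner = Sum.inr i.succ) ∨
      ((¬ ∃ i, y.map.mark i = y.map.light z) ∧ x.corner = Sum.inl (σ⁻¹ (y.map.light z))) := by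
    by_cases h : ∃ i, y.map.mark i = y.map.light z
    · obtain ⟨i, hi, hi'⟩ := PreHypermap.removeSide_corner_of_exists h
      refine Or.inl ⟨i, hi, ?_⟩
      rw [hxdef]
      simp only [CornerMap.slide, hi']
      rfl
    · refine Or.inr ⟨h, ?_⟩
      rw [hxdef]
      simp only [CornerMap.slide, PreHypermap.removeSide_corner_of_not_exists h]
      rfl
  have hcornerEdge : x.cornerEdge = σ⁻¹ (y.map.light z) := by
    rw [CornerMap.cornerEdge]
    rcases hxcorner with ⟨i, hi, hi'⟩ | ⟨_, hi'⟩
    · rw [hi', Sum.elim_inr, hxmark, if_neg (hi ▸ hne), hi]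
    · rw [hi']
      rfl
  have hxl := PreHypermap.lightNext_of_remove O hxlight
  have hxd : x.map.darkNext O = y.map.darkNext O := by cases O <;> rfl
  have S := H.isSewn hσ
  have hcyc := H.sew_sameCycle_zero hσ
  rw [he0, ← hxl, ← hxd] at S hcyc
  have hxconn : x.map.Connected := by
    -- Here `e 0` and `l (e 0)` are linked through the first sector, both of whose extremities are
    -- at the same new vertex.
    refine hm.of_isSewn hxd hxl hσ S fun r _ hr hpath hshift => ?_
    exact r.symm (r.trans (r.symm (hshift _)) (hr _ _ hcyc))
  have hxvertex : x.cornerVertex = x.map.tail O (e 0) := by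
    rw [CornerMap.cornerVertex, hcornerEdge, PreHypermap.vertexOf_corner_of_remove O hxlight]
    exact (x.map.tail_eq_tail_iff O).2 hcyc
  have hxgeo : x.map.lightestGeodesic O.rev (x.map.mark 0) x.cornerVertex
      = ((List.range k).map e).reverse := by
    rw [PreHypermap.lightestGeodesic, hxvertex, hxmark0, PreHypermap.head_rev,
      PreHypermap.dist_rev, hxconn.isSewn_dist S le_rfl]
    exact hxconn.isSewn_lightestSteps S k le_rfl
  have hrev : x.map.mark 0 :: ((List.range k).map e).reverse = L.reverse := by
    rw [hxmark0, hL, List.range_succ, List.map_append, List.reverse_append]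
    rfl
  have hinvσ : (L.reverse.formPerm)⁻¹ = σ := by rw [List.formPerm_reverse, inv_inv]
  have hxlast : ((List.range k).map e).reverse.getLastD (x.map.mark 0) = z := by
    have h₁ := congrArg (fun l => l.getLastD z) hrev
    simp only [hL, getLastD_reverse_map_range] at h₁
    rw [← he0, ← h₁]
    simp [List.getLastD_eq_getLast?, List.getLast?_cons]
  have hslide : (x.slide L.reverse).cornerEdge = y.map.light z := by
    rw [x.cornerEdge_slide, hinvσ, hcornerEdge, Equiv.Perm.apply_inv_apply]
  have hmap : (x.suppress O).map = y.map := by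
    rw [CornerMap.suppress]
    simp only [hxgeo, hrev, hxlast, CornerMap.insertSide, hslide]
    ext1
    · simp only [CornerMap.slide, hinvσ]
      rw [hxlight, List.formPerm_reverse, ← hσdef, mul_assoc, mul_assoc, mul_assoc σ⁻¹,
        mul_inv_cancel_left, mul_assoc, mul_inv_cancel, mul_one, ← mul_assoc,
        Equiv.swap_mul_self, one_mul]
    · exact hxdark
    · funext i
      rcases hxcorner with ⟨j, hj, hj'⟩ | ⟨hno, hj'⟩
      · simp only [CornerMap.slide, hinvσ, hj', Sum.map_inr, Sum.elim_inr]
        rcases hR i with ⟨h₁, h₂⟩ | ⟨h₁, h₂⟩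
        -- The face of `z` would have its mark both at `z` and at `light z`, which are distinct.
        · exfalso
          have hij : i = j := (hmarked (y.map.light z)).unique
            (by rw [h₁]; exact Equiv.Perm.sameCycle_apply_right.2 (Equiv.Perm.SameCycle.refl _ _))
            (by rw [hj]; exact Equiv.Perm.SameCycle.refl _ _)
          rw [hij, hj] at h₁
          exact hne h₁
        · exact h₂
      · simp only [CornerMap.slide, hinvσ, hj', Sum.map_inl, Sum.elim_inl,
          Equiv.Perm.apply_inv_apply]
        rcases hR i with ⟨h₁, h₂⟩ | ⟨h₁, h₂⟩
        · rw [if_pos h₂, h₁]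
        · rw [h₂, if_neg fun h => hno ⟨i, h⟩]
  refine ⟨?_, hxconn, σ⁻¹, ⟨?_, ?_, ?_, ?_, ?_, ?_⟩, ?_⟩
  · ext1
    · exact hmap
    · have h₁ : (x.suppress O).vertex = (x.suppress O).map.tail O.rev (x.map.mark 0) := rfl
      rw [h₁, hmap, hxmark0, PreHypermap.tail_rev, ht, PreHypermap.head_eq_tail_lightNext]
      exact hm.tail_eq_of_dist_eq_zero (Nat.add_eq_right.1 (H.label_end k le_rfl))
    · have h₁ : (x.suppress O).edge = (x.map.lightestGeodesic O.rev (x.map.mark 0)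
        x.cornerVertex).getLastD (x.map.mark 0) := rfl
      rw [h₁, hxgeo, hxlast]
  · rw [hxlight, hcornerEdge, inv_inv, Equiv.Perm.apply_inv_apply]
    have h₁ : σ * (σ⁻¹ * (Equiv.swap z (y.map.light z) * y.map.light) * σ) * σ⁻¹
        = Equiv.swap z (y.map.light z) * y.map.light := by group
    rw [h₁, Equiv.swap_mul_self_mul]
  · rw [hxmark0, ← he0, hσ.inv_zero]
  · rw [hxmark0, hxlight]
    simp only [Equiv.Perm.mul_apply]
    rw [hσ.apply_last, he0, Equiv.swap_apply_right, ← he0, hσ.inv_zero]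
  · rw [hcornerEdge, inv_inv, Equiv.Perm.apply_inv_apply]
    exact hne
  · intro i
    rw [inv_inv]
    rcases hR i with ⟨h₁, h₂⟩ | ⟨h₁, h₂⟩
    · rw [h₂, h₁, Equiv.Perm.sameCycle_apply_right]
    · rw [h₂]
  · intro i hi
    rw [hxmark0] at hi
    have h₀ : σ (x.map.mark i.succ) = z := by rw [hi, hσ.apply_last, he0]
    rcases hR i with ⟨h₁, h₂⟩ | ⟨h₁, h₂⟩
    · exact hne (h₂.symm.trans h₀)
    · exact h₁ (h₂.symm.trans h₀)
  · intro j hj hz'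
    rcases hxcorner with ⟨i, hi, hi'⟩ | ⟨_, hi'⟩
    · rw [hi', Sum.inr.injEq] at hj
      have hi0 : i = 0 := (hmarked (y.map.light z)).unique
        (by rw [hi]; exact Equiv.Perm.SameCycle.refl _ _)
        (Equiv.Perm.sameCycle_apply_right.2 hz')
      rw [← hj, hi0, Fin.succ_zero_eq_one]
    · rw [hi'] at hj
      exact absurd hj Sum.inl_ne_inr

end Operations

/-! ### Hypermaps of the prescribed types. -/

section Bijection

variable {E : Type*}

theorem PreHypermap.injective_mark {ι : Type*} {m : PreHypermap E ι}
    (h : ∀ u, ∃! i, u ∈ m.lightFace (m.mark i)) : Function.Injective m.mark := fun i j hij =>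
  (h (m.mark i)).unique (Equiv.Perm.SameCycle.refl _ _)
    (by rw [hij]; exact Equiv.Perm.SameCycle.refl _ _)

theorem PreHypermap.light_eq_self_of_ncard {ι : Type*} {m : PreHypermap E ι} {e : E}
    (h : (m.lightFace e).ncard = 1) : m.light e = e := by
  obtain ⟨u, hu⟩ := Set.ncard_eq_one.1 h
  have h₁ : e ∈ m.lightFace e := Equiv.Perm.SameCycle.refl _ _
  have h₂ : m.light e ∈ m.lightFace e :=
    Equiv.Perm.sameCycle_apply_right.2 (Equiv.Perm.SameCycle.refl _ _)
  rw [hu] at h₁ h₂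
  exact h₂.trans h₁.symm

theorem PreHypermap.ncard_eq_one_of_light_eq_self {ι : Type*} {m : PreHypermap E ι} {e : E}
    (h : m.light e = e) : (m.lightFace e).ncard = 1 :=
  Set.ncard_eq_one.2 ⟨e, Set.ext fun _ =>
    ⟨fun hu => (Equiv.Perm.SameCycle.eq_of_left hu h).symm,
      fun hu => hu ▸ Equiv.Perm.SameCycle.refl _ _⟩⟩

theorem CornerMap.cornerEdge_mem {ι : Type*} {x : CornerMap E ι} {i : ι} (h : x.CornerInFace i) :
    x.cornerEdge ∈ x.map.lightFace (x.map.mark i) := by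
  rw [CornerInFace] at h
  rw [cornerEdge]
  rcases hc : x.corner with q | j
  · rwa [hc] at h
  · rw [hc] at h
    obtain rfl : j = i := h
    exact Equiv.Perm.SameCycle.refl _ _

variable [DecidableEq E] [Finite E] {s p : ℕ} {a : Fin (s + 2) → ℕ} {b : Fin (s + 1) → ℕ}

/-- Suppressing the face of degree one yields a hypermap of the expected type, and it is
undone by `addFace`. -/
theorem CornerMap.suppress_valid (O : EdgeOrientation) (ha_one : a 0 = 1)
    (hb_zero : b 0 = a 1 + 1) (hb_succ : ∀ i : Fin s, b i.succ = a i.succ.succ)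
    {x : CornerMap E (Fin (s + 2))} (hx : x.map.IsHypermap p) (ha : x.map.HasType a)
    (hc : x.CornerInFace 1) :
    ((x.suppress O).map.IsHypermap p ∧ (x.suppress O).map.HasType b ∧
      (x.suppress O).vertex ∈ Set.range (x.suppress O).map.vertexOf ∧
      (x.suppress O).edge ∈ (x.suppress O).map.lightFace ((x.suppress O).map.mark 0) ∧
      (x.suppress O).map.IsLeaving O.rev (x.suppress O).vertex (x.suppress O).edge) ∧
      (x.suppress O).addFace O = x := by
  have hfix : x.map.light (x.map.mark 0) = x.map.mark 0 :=
    PreHypermap.light_eq_self_of_ncard ((ha 0).trans ha_one)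
  have hmem := CornerMap.cornerEdge_mem hc
  have hne : x.cornerEdge ≠ x.map.mark 0 := by
    intro h
    rw [h] at hmem
    have := (hx.marked (x.map.mark 0)).unique hmem (Equiv.Perm.SameCycle.refl _ _)
    exact absurd this (by simp)
  have hc' : x.corner ≠ Sum.inr 0 := by
    intro h
    rw [CornerInFace, h] at hc
    exact absurd (show (0 : Fin (s + 2)) = 1 from hc) (by simp)
  obtain ⟨hadd, hconn, hcard, hvertex, hleave, σ, H⟩ :=
    x.suppress_spec O hx.connected hfix (PreHypermap.injective_mark hx.marked) hne hc'
  have hmarked := H.marked_iff.1 hx.marked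
  have hσc : σ (σ⁻¹ x.cornerEdge) ∈ x.map.lightFace (x.map.mark 1) := by
    rwa [Equiv.Perm.apply_inv_apply]
  refine ⟨⟨⟨hconn, ?_, hx.dark_degree, hmarked⟩,
    (H.hasType_iff ha_one hb_zero hb_succ hx.marked hσc).1 ha, hvertex,
    (H.edge_mem_iff 0).2 hσc, hleave⟩, hadd⟩
  -- One light face is lost and one vertex gained, with the same edges and dark faces.
  have h₁ := hx.euler
  rw [PreHypermap.ncard_range_lightFace hx.marked] at h₁
  rw [PreHypermap.ncard_range_lightFace hmarked, hcard]
  have h₂ : (Set.range (x.suppress O).map.darkFace) = Set.range x.map.darkFace := rfl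
  rw [h₂]
  simp only [Nat.card_fin] at h₁ ⊢
  omega

/-- Adding a face of degree one yields a hypermap of the expected type, and it is
undone by `suppress`. -/
theorem VertexEdgeMap.addFace_valid (O : EdgeOrientation) (ha_pos : 0 < a 1) (ha_one : a 0 = 1)
    (hb_zero : b 0 = a 1 + 1) (hb_succ : ∀ i : Fin s, b i.succ = a i.succ.succ)
    {y : VertexEdgeMap E (Fin (s + 1))} (hy : y.map.IsHypermap p) (hb : y.map.HasType b)
    (hv : y.vertex ∈ Set.range y.map.vertexOf)
    (he : y.edge ∈ y.map.lightFace (y.map.mark 0))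
    (hleave : y.map.IsLeaving O.rev y.vertex y.edge) :
    ((y.addFace O).map.IsHypermap p ∧ (y.addFace O).map.HasType a ∧
      (y.addFace O).CornerInFace 1) ∧ (y.addFace O).suppress O = y := by
  -- The face of the distinguished edge has degree `a 1 + 1`, which is at least `2`, so another side
  -- remains after the removal.
  have hne : y.map.light y.edge ≠ y.edge := by
    intro h
    have h₁ := PreHypermap.ncard_eq_one_of_light_eq_self h
    have h₂ : y.map.lightFace y.edge = y.map.lightFace (y.map.mark 0) :=
      (Equiv.Perm.cycleSet_eq_iff (g := y.map.light)).2 (Equiv.Perm.SameCycle.symm he)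
    have h₃ := hb 0
    rw [← h₂, h₁] at h₃
    omega
  obtain ⟨hsup, hconn, σ, H, hcor⟩ := y.addFace_spec O hy.connected hne hy.marked hv hleave
  set x := y.addFace O with hx
  have hmarked : ∀ u, ∃! i, u ∈ x.map.lightFace (x.map.mark i) := H.marked_iff.2 hy.marked
  have hσc := (H.edge_mem_iff 0).1 he
  rw [Fin.succ_zero_eq_one] at hσc
  have htype := (H.hasType_iff ha_one hb_zero hb_succ hmarked hσc).2 hb
  rw [Equiv.Perm.apply_inv_apply] at hσc
  have hc : x.CornerInFace 1 := by
    rw [CornerMap.CornerInFace]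
    rcases hxc : x.corner with q | j
    · rwa [CornerMap.cornerEdge, hxc] at hσc
    · exact hcor j hxc he
  have hne' : x.cornerEdge ≠ x.map.mark 0 := by
    intro h
    rw [h] at hσc
    have := (hmarked (x.map.mark 0)).unique hσc (Equiv.Perm.SameCycle.refl _ _)
    exact absurd this (by simp)
  have hc' : x.corner ≠ Sum.inr 0 := fun h => absurd (hcor 0 h he) (by simp)
  -- The vertices are counted by suppressing the new face again, which gives back `y`.
  obtain ⟨_, _, hcard, _⟩ :=
    x.suppress_spec O hconn H.fix (PreHypermap.injective_mark hmarked) hne' hc'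
  refine ⟨⟨⟨hconn, ?_, hy.dark_degree, hmarked⟩, htype, hc⟩, hsup⟩
  have h₁ := hy.euler
  rw [PreHypermap.ncard_range_lightFace hy.marked] at h₁
  rw [PreHypermap.ncard_range_lightFace hmarked]
  rw [hsup] at hcard
  have h₂ : (Set.range x.map.darkFace) = Set.range y.map.darkFace := rfl
  rw [h₂]
  simp only [Nat.card_fin] at h₁ ⊢
  omega

end Bijection

/-- Both types have the same sum because `b 0 = a 1 + a 0`, so the single edge set `Fin n` serves on
both sides. The inverse relations hold for labelled representatives and pass to isomorphism classes.
-/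
theorem theorem2 (p : ℕ) (hp : 2 ≤ p) (O : EdgeOrientation)
    (s : ℕ) (a : Fin (s + 2) → ℕ) (b : Fin (s + 1) → ℕ)
    (ha_pos : ∀ i, 0 < a i)
    (ha_one : a 0 = 1)
    (hb_zero : b 0 = a 1 + 1)
    (hb_succ : ∀ i : Fin s, b i.succ = a i.succ.succ)
    (ha_flawed : {i | ¬ p ∣ a i}.ncard ≤ 2)
    (hb_flawed : {i | ¬ p ∣ b i}.ncard ≤ 2)
    (n : ℕ) (hn : n = ∑ i, a i) :
    Set.BijOn (psiMinus O) (cornerMaps p n a) (vertexEdgeMaps p n O b) ∧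
    Set.BijOn (psiPlus O) (vertexEdgeMaps p n O b) (cornerMaps p n a) ∧
    Set.InvOn (psiPlus O) (psiMinus O) (cornerMaps p n a) (vertexEdgeMaps p n O b) := by
  have hminus : Set.MapsTo (psiMinus O) (cornerMaps p n a) (vertexEdgeMaps p n O b) := by
    rintro _ ⟨x, rfl, hx, ha, hc⟩
    exact ⟨x.suppress O, rfl, (CornerMap.suppress_valid O ha_one hb_zero hb_succ hx ha hc).1⟩
  have hplus : Set.MapsTo (psiPlus O) (vertexEdgeMaps p n O b) (cornerMaps p n a) := by
    rintro _ ⟨y, rfl, hy, hb, hv, he, hl⟩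
    exact ⟨y.addFace O, rfl, (VertexEdgeMap.addFace_valid O (ha_pos 1) ha_one hb_zero hb_succ
      hy hb hv he hl).1⟩
  have hinv : Set.InvOn (psiPlus O) (psiMinus O) (cornerMaps p n a) (vertexEdgeMaps p n O b) := by
    constructor
    · rintro _ ⟨x, rfl, hx, ha, hc⟩
      exact congrArg (Quotient.mk _)
        (CornerMap.suppress_valid O ha_one hb_zero hb_succ hx ha hc).2
    · rintro _ ⟨y, rfl, hy, hb, hv, he, hl⟩
      exact congrArg (Quotient.mk _) (VertexEdgeMap.addFace_valid O (ha_pos 1) ha_one hb_zero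
        hb_succ hy hb hv he hl).2
  exact ⟨hinv.bijOn hminus hplus, hinv.symm.bijOn hplus hminus, hinv⟩
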